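/- **Absorbing lemma.** A $3$-graph $H$ consists of a finite vertex set $V(H)$ and a set $E(H)$ of $3$-element subsets of $V(H)$. Its minimum codegree $\delta(H)$ is the minimum, over all pairs of distinct vertices $x,y\in V(H)$, of the number of edges of $H$ containing both $x$ and $y$. Let $T$ be the generalised triangle, i.e. the $3$-graph with five vertices $a,b,c,d,e$ and three edges $abc$, $abd$, $cde$. A perfect $T$-tiling in a $3$-graph $G$ is a set of pairwise vertex-disjoint (not necessarily induced) subgraphs of $G$, each isomorphic to $T$, which together cover every vertex of $G$. For every $\alpha>0$ there exists $c_0>0$ such that for every $c$ with $0<c<c_0$ there exists $n_0\in\mathbb{N}$ for which the following holds. Let $H$ be a $3$-graph on $n\ge n_0$ vertices with $\delta(H)\ge n/3+\alpha n$. Then there exists a set $A\subseteq V(H)$ with $|A|\le cn$ such that, for every $S\subseteq V(H)\setminus A$ with $|S|\le c^2n$ and $5\mid |S|$, the induced subgraph $H[A\cup S]$ has a perfect $T$-tiling. -/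

import Mathlib

/-- A finite `k`-uniform hypergraph whose vertices are taken from an ambient type `V`. -/
@[ext]
structure KGraph (k : ℕ) (V : Type*) where
  /-- the vertex set -/
  verts : Finset V
  /-- the edge set -/
  edges : Finset (Finset V)
  subset_verts : ∀ e ∈ edges, e ⊆ verts
  card_edge : ∀ e ∈ edges, e.card = k

namespace KGraph

/-- The degree of a set `f` of vertices: the number of edges containing `f`. -/
def degree {k : ℕ} {V : Type*} [DecidableEq V] (H : KGraph k V) (f : Finset V) : ℕ :=
  (H.edges.filter (fun e => f ⊆ e)).card

/-- The minimum codegree: the minimum of the degrees of the sets of `k - 1` vertices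
(`0` if there is no such set). -/
noncomputable def minCodegree {k : ℕ} {V : Type*} [DecidableEq V] (H : KGraph k V) : ℕ :=
  sInf {d : ℕ | ∃ f : Finset V, f ⊆ H.verts ∧ f.card = k - 1 ∧ d = H.degree f}

/-- The induced subgraph `H[U]`; here `U` is meant to be a set of vertices of `H`. -/
def induce {k : ℕ} {V : Type*} [DecidableEq V] (H : KGraph k V) (U : Finset V) : KGraph k V where
  verts := H.verts ∩ U
  edges := H.edges.filter (fun e => e ⊆ U)
  subset_verts := fun e he => by
    rw [Finset.mem_filter] at he
    exact Finset.subset_inter (H.subset_verts e he.1) he.2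
  card_edge := fun e he => H.card_edge e (Finset.mem_filter.mp he).1

/-- `P` is a subgraph of `H`, not necessarily induced. -/
def IsSubgraph {k : ℕ} {V : Type*} (P H : KGraph k V) : Prop :=
  P.verts ⊆ H.verts ∧ P.edges ⊆ H.edges

/-- `P` is isomorphic to `F`: some map that is injective on the vertices of `F` carries
the vertex set and the edge set of `F` onto those of `P`. -/
def IsCopy {k : ℕ} {W V : Type*} [DecidableEq V] (F : KGraph k W) (P : KGraph k V) : Prop :=
  ∃ φ : W → V, Set.InjOn φ (F.verts : Set W) ∧
    P.verts = F.verts.image φ ∧ P.edges = F.edges.image (fun e => e.image φ)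

/-- `𝓕` is an `F`-tiling in `H`: a set of vertex-disjoint copies of `F` in `H`. -/
def IsTiling {k : ℕ} {W V : Type*} [DecidableEq V] (F : KGraph k W) (H : KGraph k V)
    (𝓕 : Set (KGraph k V)) : Prop :=
  (∀ P ∈ 𝓕, P.IsSubgraph H ∧ F.IsCopy P) ∧
    𝓕.Pairwise (fun P Q => Disjoint P.verts Q.verts)

/-- `H` has a perfect `F`-tiling: an `F`-tiling covering every vertex of `H`. -/
def HasPerfectTiling {k : ℕ} {W V : Type*} [DecidableEq V] (F : KGraph k W) (H : KGraph k V) :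
    Prop :=
  ∃ 𝓕 : Set (KGraph k V), IsTiling F H 𝓕 ∧ ∀ v ∈ H.verts, ∃ P ∈ 𝓕, v ∈ P.verts

end KGraph

/-- The generalised triangle: five vertices `a, b, c, d, e` (here `0, 1, 2, 3, 4`) and the three
edges `abc`, `abd`, `cde`. -/
def generalisedTriangle : KGraph 3 (Fin 5) where
  verts := Finset.univ
  edges := {{0, 1, 2}, {0, 1, 3}, {2, 3, 4}}
  subset_verts := fun e _ => Finset.subset_univ e
  card_edge := by decide

/-! The proof is an absorption argument. A list `l` exchanges `x` for `y` if both `l + x` and `l +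
y` can be tiled. The core, `CodegreeGE.many_exchanges`, says that any two vertices are exchanged by
a positive proportion of the lists of 14 vertices. A 5-set `S` is then absorbed by many lists of 75
vertices: a copy of T followed by five exchange lists, each matching one vertex of the copy with one
vertex of `S`. Without `S`, the copy's vertices are tiled with the exchange lists; with `S`, the
vertices of `S` take over that role and the copy is a tile by itself. Linearly many disjoint
absorbers form the absorbing set, and a leftover set is swallowed five vertices at a time.

For the core, every link has density above 1/3, so two of any three vertices are close: their links
share a positive proportion of pairs. Close vertices are exchanged directly. Vertices `x`, `y` that
are not close may be joined through one or two intermediate vertices. If there are too few such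
chains, the sets `A` (not close to `y`, hence close to `x`) and `C` (not close to `x`, hence close
to `y`) nearly partition the vertex set, and few pairs across are close. Most cross pairs then have
almost no neighbours in one of the two parts. Cauchy–Schwarz yields many quadruples `c, d, b, e`
that exchange a vertex `a ∈ A` for a vertex `f ∈ C`, with `a` and `f` in different roles of T, and
the chain `x, a, f, y` finishes.

The absorbers are picked greedily rather than at random: a 5-set has weight `2^(-k)` when it has `k`
absorbers so far, and every pick reduces the total weight by a constant factor. -/

open Finset

-- Indicator sums and nested counting quantifiers

universe u

/-- The real-valued indicator of a proposition. -/
noncomputable def indic (p : Prop) : ℝ := open Classical in if p then 1 else 0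

theorem indic_of {p : Prop} (h : p) : indic p = 1 := by simp [indic, h]

theorem indic_of_not {p : Prop} (h : ¬ p) : indic p = 0 := by simp [indic, h]

theorem indic_nonneg (p : Prop) : 0 ≤ indic p := by
  by_cases h : p <;> simp [indic, h]

theorem indic_le_one (p : Prop) : indic p ≤ 1 := by
  by_cases h : p <;> simp [indic, h]

theorem indic_mono {p q : Prop} (h : p → q) : indic p ≤ indic q := by
  by_cases hp : p
  · rw [indic_of hp, indic_of (h hp)]
  · rw [indic_of_not hp]; exact indic_nonneg q

theorem indic_and (p q : Prop) : indic (p ∧ q) = indic p * indic q := by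
  by_cases hp : p <;> by_cases hq : q <;> simp [indic, hp, hq]

theorem indic_or_le (p q : Prop) : indic (p ∨ q) ≤ indic p + indic q := by
  by_cases hp : p <;> by_cases hq : q <;> simp [indic, hp, hq]

theorem indic_sub_le (p q : Prop) : indic p - indic q ≤ indic (p ∧ ¬ q) := by
  by_cases hp : p <;> by_cases hq : q <;> simp [indic, hp, hq]

theorem sum_indic_le_card {V : Type u} (X : Finset V) (p : V → Prop) :
    ∑ v ∈ X, indic (p v) ≤ X.card := by
  calc ∑ v ∈ X, indic (p v) ≤ ∑ _v ∈ X, (1 : ℝ) := sum_le_sum fun v _ => indic_le_one _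
    _ = X.card := by simp

theorem sum_indic_eq_card_filter {V : Type u} (X : Finset V) (p : V → Prop) [DecidablePred p] :
    ∑ v ∈ X, indic (p v) = (X.filter p).card := by
  rw [card_filter, Nat.cast_sum]
  refine sum_congr rfl fun v _ => ?_
  by_cases h : p v <;> simp [indic, h]

theorem sum_indic_eq_le_one {V : Type u} [DecidableEq V] (X : Finset V) (c : V) :
    ∑ d ∈ X, indic (d = c) ≤ 1 := by
  rw [sum_indic_eq_card_filter]
  have h : (X.filter fun d => d = c).card ≤ 1 := card_le_one.2 fun a ha b hb =>
    (mem_filter.1 ha).2.trans (mem_filter.1 hb).2.symm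
  exact_mod_cast h

/-- `Many X β k P`: for at least `β |X|` choices of `v₁ ∈ X`, for at least `β |X|` choices of
`v₂ ∈ X`, and so on, the list `[v₁, …, vₖ]` satisfies `P`. -/
def Many {V : Type u} (X : Finset V) (β : ℝ) : ℕ → (List V → Prop) → Prop
  | 0, P => P []
  | k + 1, P => β * X.card ≤ ∑ v ∈ X, indic (Many X β k fun l => P (v :: l))

namespace Many

variable {V : Type u} {X : Finset V} {β β' : ℝ} {k k' : ℕ} {P Q : List V → Prop}

theorem mono (h : Many X β k P) (hβ : β' ≤ β)
    (hPQ : ∀ l : List V, l.length = k → (∀ v ∈ l, v ∈ X) → P l → Q l) : Many X β' k Q := by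
  induction k generalizing P Q with
  | zero => exact hPQ [] rfl (by simp) h
  | succ k ih =>
    simp only [Many] at h ⊢
    refine (mul_le_mul_of_nonneg_right hβ (Nat.cast_nonneg _)).trans (h.trans ?_)
    refine sum_le_sum fun v hv => indic_mono fun hm => ih hm fun l hl hX hP => ?_
    refine hPQ _ (by simp [hl]) ?_ hP
    simpa [hv] using hX

/-- The quantifiers are nested, so a second batch of entries may be chosen depending on the first.
-/
theorem append (h : Many X β k fun l => Many X β k' fun l' => P (l ++ l')) :
    Many X β (k + k') P := by
  induction k generalizing P with
  | zero => simpa [Many] using h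
  | succ k ih =>
    rw [Nat.succ_add]
    simp only [Many] at h ⊢
    exact h.trans (sum_le_sum fun v _ => indic_mono fun hm => ih hm)

theorem cons (h : β * X.card ≤ ∑ v ∈ X, indic (Many X β k fun l => P (v :: l))) :
    Many X β (k + 1) P := h

theorem cons_of_forall {p : V → Prop} (h : β * X.card ≤ ∑ v ∈ X, indic (p v))
    (hp : ∀ v ∈ X, p v → Many X β k fun l => P (v :: l)) : Many X β (k + 1) P :=
  cons (h.trans (sum_le_sum fun v hv => indic_mono (hp v hv)))

/-- At each stage `U` and the entries already chosen exclude at most half of the `β |X|` available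
choices. -/
theorem avoid [DecidableEq V] (h : Many X β k P) (U : Finset V)
    (hU : (U.card : ℝ) + k ≤ β / 2 * X.card) :
    Many X (β / 2) k fun l => P l ∧ l.Nodup ∧ ∀ v ∈ l, v ∉ U := by
  induction k generalizing P U with
  | zero => exact ⟨h, by simp⟩
  | succ k ih =>
    simp only [Many] at h
    push_cast at hU
    have h1 : ∑ v ∈ X, indic (v ∈ U) ≤ U.card := by
      classical
      rw [sum_indic_eq_card_filter]
      exact_mod_cast card_le_card fun v hv => (mem_filter.1 hv).2
    have h2 : ∑ v ∈ X, indic (Many X β k fun l => P (v :: l)) - ∑ v ∈ X, indic (v ∈ U) ≤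
        ∑ v ∈ X, indic ((Many X β k fun l => P (v :: l)) ∧ v ∉ U) := by
      rw [← sum_sub_distrib]
      exact sum_le_sum fun v _ => indic_sub_le _ _
    have hk : (0 : ℝ) ≤ k := Nat.cast_nonneg k
    refine cons_of_forall (p := fun v => (Many X β k fun l => P (v :: l)) ∧ v ∉ U)
      (by linarith) fun v _ ⟨hm, hv⟩ => ?_
    refine (ih hm (insert v U) ?_).mono le_rfl fun l _ _ ⟨hP, hn, ha⟩ => ⟨hP, ?_, ?_⟩
    · have : ((insert v U).card : ℝ) ≤ U.card + 1 := by exact_mod_cast card_insert_le v U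
      linarith
    · exact List.nodup_cons.2 ⟨fun hl => ha v hl (mem_insert_self v U), hn⟩
    · intro w hw
      rcases List.mem_cons.1 hw with rfl | hw
      · exact hv
      · exact fun hU => ha w hw (mem_insert_of_mem hU)

/-- A weighted averaging argument: a single list satisfies a fixed proportion of the
properties `P i`. -/
theorem exists_weight {ι : Type*} (hX : X.Nonempty) (hβ : 0 ≤ β) (s : Finset ι) (w : ι → ℝ)
    (hw : ∀ i, 0 ≤ w i) (P : ι → List V → Prop) (h : ∀ i ∈ s, Many X β k (P i)) :
    ∃ l : List V, l.length = k ∧ (∀ v ∈ l, v ∈ X) ∧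
      β ^ k * ∑ i ∈ s, w i ≤ ∑ i ∈ s, w i * indic (P i l) := by
  classical
  induction k generalizing P s with
  | zero =>
    refine ⟨[], rfl, by simp, ?_⟩
    rw [pow_zero, one_mul]
    exact (sum_congr rfl fun i hi => by rw [indic_of (p := P i []) (h i hi), mul_one]).le
  | succ k ih =>
    have hsum : ∑ _v ∈ X, β * ∑ i ∈ s, w i ≤
        ∑ v ∈ X, ∑ i ∈ s, w i * indic (Many X β k fun l => P i (v :: l)) := by
      rw [sum_comm, sum_const, nsmul_eq_mul]
      calc (X.card : ℝ) * (β * ∑ i ∈ s, w i) = ∑ i ∈ s, w i * (β * X.card) := by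
            rw [← sum_mul]; ring
        _ ≤ ∑ i ∈ s, w i * ∑ v ∈ X, indic (Many X β k fun l => P i (v :: l)) :=
            sum_le_sum fun i hi => mul_le_mul_of_nonneg_left (h i hi) (hw i)
        _ = _ := sum_congr rfl fun i _ => mul_sum _ _ _
    obtain ⟨v, hv, hvle⟩ := exists_le_of_sum_le hX hsum
    obtain ⟨l, hl, hlX, hle⟩ := ih (s.filter fun i => Many X β k fun l => P i (v :: l))
      (fun i l => P i (v :: l)) fun i hi => (mem_filter.1 hi).2
    refine ⟨v :: l, by simp [hl], by simpa [hv] using hlX, ?_⟩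
    have e1 : ∑ i ∈ s.filter (fun i => Many X β k fun l => P i (v :: l)), w i =
        ∑ i ∈ s, w i * indic (Many X β k fun l => P i (v :: l)) := by
      rw [sum_filter]
      refine sum_congr rfl fun i _ => ?_
      by_cases hm : Many X β k fun l => P i (v :: l) <;> simp [indic, hm]
    calc β ^ (k + 1) * ∑ i ∈ s, w i = β ^ k * (β * ∑ i ∈ s, w i) := by ring
      _ ≤ β ^ k * ∑ i ∈ s.filter (fun i => Many X β k fun l => P i (v :: l)), w i := by
          rw [e1]; exact mul_le_mul_of_nonneg_left hvle (pow_nonneg hβ k)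
      _ ≤ _ := hle
      _ ≤ _ := sum_le_sum_of_subset_of_nonneg (filter_subset _ _) fun i _ _ =>
          mul_nonneg (hw i) (indic_nonneg _)

end Many

/-! ### From the number of lists to nested quantifiers -/

/-- The number of lists of length `k` with entries in `X` that satisfy `P`. -/
noncomputable def listCount {V : Type u} (X : Finset V) : ℕ → (List V → Prop) → ℝ
  | 0, P => indic (P [])
  | k + 1, P => ∑ v ∈ X, listCount X k fun l => P (v :: l)

theorem listCount_le {V : Type u} (X : Finset V) (k : ℕ) (P : List V → Prop) :
    listCount X k P ≤ (X.card : ℝ) ^ k := by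
  induction k generalizing P with
  | zero => simpa [listCount] using indic_le_one _
  | succ k ih =>
    simp only [listCount]
    refine (sum_le_sum fun v _ => ih _).trans ?_
    rw [sum_const, nsmul_eq_mul, pow_succ']

/-- If the values of `f` on `X` are at most `M` and sum up to at least `β M |X|`, then `f` is at
least `(β / 2) M` on a `β / 2` proportion of `X`. -/
theorem half_mul_card_le_sum_indic {V : Type u} {X : Finset V} {f : V → ℝ} {β M : ℝ}
    (hM : 0 < M) (hf : ∀ v ∈ X, f v ≤ M) (hβ : 0 ≤ β) (h : β * M * X.card ≤ ∑ v ∈ X, f v) :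
    β / 2 * X.card ≤ ∑ v ∈ X, indic (β / 2 * M ≤ f v) := by
  have h1 : ∑ v ∈ X, f v ≤ ∑ v ∈ X, (M * indic (β / 2 * M ≤ f v) + β / 2 * M) := by
    refine sum_le_sum fun v hv => ?_
    by_cases hc : β / 2 * M ≤ f v
    · rw [indic_of hc]
      have := hf v hv
      have : 0 ≤ β / 2 * M := by positivity
      linarith
    · rw [indic_of_not hc]; push Not at hc; linarith
  rw [sum_add_distrib, ← mul_sum, sum_const, nsmul_eq_mul] at h1
  have h2 : M * (β / 2 * X.card) ≤ M * ∑ v ∈ X, indic (β / 2 * M ≤ f v) := by linarith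
  exact le_of_mul_le_mul_left h2 hM

/-- One entry is split off at a time. Each averaging step halves the density, whence the factor `2 ^
k`. -/
theorem Many.of_listCount {V : Type u} {X : Finset V} (hX : X.Nonempty) {β : ℝ} (hβ : 0 < β)
    {k : ℕ} {P : List V → Prop} (h : β * (X.card : ℝ) ^ k ≤ listCount X k P) :
    Many X (β / 2 ^ k) k P := by
  have hc : (0 : ℝ) < X.card := by exact_mod_cast hX.card_pos
  induction k generalizing P β with
  | zero =>
    by_contra hP
    simp only [Many] at hP
    simp only [listCount, indic_of_not hP] at h
    simp at h; linarith
  | succ k ih =>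
    have h1 := half_mul_card_le_sum_indic (X := X) (f := fun v => listCount X k fun l => P (v :: l))
      (β := β) (M := (X.card : ℝ) ^ k) (by positivity) (fun v _ => listCount_le _ _ _) hβ.le
      (by rw [mul_assoc, ← pow_succ]; exact h)
    refine Many.cons_of_forall (p := fun v => β / 2 * (X.card : ℝ) ^ k ≤
      listCount X k fun l => P (v :: l)) (le_trans ?_ h1) fun v _ hv => ?_
    · refine mul_le_mul_of_nonneg_right ?_ hc.le
      refine div_le_div_of_nonneg_left hβ.le two_pos ?_
      rw [pow_succ]
      have : (1 : ℝ) ≤ 2 ^ k := one_le_pow₀ (by norm_num)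
      linarith
    · have := ih (by positivity) hv
      rwa [div_div, ← pow_succ'] at this

/-! ### Tileable sets and exchange lists -/

namespace KGraph

variable {V : Type u} [DecidableEq V] {H : KGraph 3 V}

/-- `{u, v, w}` is an edge of the `3`-graph `H`. -/
def Adj (H : KGraph 3 V) (u v w : V) : Prop := ({u, v, w} : Finset V) ∈ H.edges

theorem adj_swap_left {u v w : V} : H.Adj u v w ↔ H.Adj v u w := by
  unfold Adj; rw [insert_comm]

theorem adj_swap_right {u v w : V} : H.Adj u v w ↔ H.Adj u w v := by
  unfold Adj; rw [pair_comm]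

theorem adj_rotate {u v w : V} : H.Adj u v w ↔ H.Adj v w u := by
  rw [adj_swap_left, adj_swap_right]

theorem Adj.ne {u v w : V} (h : H.Adj u v w) : u ≠ v := by
  rintro rfl
  have h3 := H.card_edge _ h
  simp only [mem_insert, mem_singleton, true_or, insert_eq_of_mem] at h3
  exact absurd (card_le_two (a := u) (b := w)) (by omega)

theorem Adj.ne_left {u v w : V} (h : H.Adj u v w) : u ≠ w := (adj_swap_right.1 h).ne

theorem Adj.mem {u v w : V} (h : H.Adj u v w) : u ∈ H.verts ∧ v ∈ H.verts ∧ w ∈ H.verts :=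
  ⟨H.subset_verts _ h (by simp), H.subset_verts _ h (by simp), H.subset_verts _ h (by simp)⟩

/-- The set `s` is a disjoint union of vertex sets of generalised triangles of `H`. -/
inductive Tileable (H : KGraph 3 V) : Finset V → Prop
  | empty : Tileable H ∅
  | union {s : Finset V} {a b c d e : V} (hs : Tileable H s) (h₁ : H.Adj a b c)
      (h₂ : H.Adj a b d) (h₃ : H.Adj c d e) (hn : [a, b, c, d, e].Nodup)
      (hd : Disjoint s [a, b, c, d, e].toFinset) : Tileable H (s ∪ [a, b, c, d, e].toFinset)

theorem tileable_of_adj {a b c d e : V} (h₁ : H.Adj a b c) (h₂ : H.Adj a b d)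
    (h₃ : H.Adj c d e) (hn : [a, b, c, d, e].Nodup) :
    H.Tileable [a, b, c, d, e].toFinset := by
  have := Tileable.union .empty h₁ h₂ h₃ hn (disjoint_empty_left _)
  rwa [empty_union] at this

theorem Tileable.disjoint_union {s t : Finset V} (hs : H.Tileable s) (ht : H.Tileable t)
    (hd : Disjoint s t) : H.Tileable (s ∪ t) := by
  induction ht with
  | empty => simpa
  | union ht h₁ h₂ h₃ hn hd' ih =>
    rw [disjoint_union_right] at hd
    rw [← union_assoc]
    exact (ih hd.1).union h₁ h₂ h₃ hn (disjoint_union_left.2 ⟨hd.2, hd'⟩)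

/-- The clause `P.verts ⊆ s` keeps a new copy disjoint from the earlier ones in the induction, and
later places the tiling inside the induced subgraph. -/
theorem Tileable.exists_tiling {s : Finset V} (hs : H.Tileable s) :
    ∃ 𝓕 : Set (KGraph 3 V), IsTiling generalisedTriangle H 𝓕 ∧ (∀ P ∈ 𝓕, P.verts ⊆ s) ∧
      ∀ v ∈ s, ∃ P ∈ 𝓕, v ∈ P.verts := by
  induction hs with
  | empty => exact ⟨∅, ⟨by simp, Set.pairwise_empty _⟩, by simp, by simp⟩
  | @union s a b c d e hs h₁ h₂ h₃ hn hd ih =>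
    obtain ⟨𝓕, ⟨hF, hP⟩, hsub, hcov⟩ := ih
    let Q : KGraph 3 V :=
      { verts := [a, b, c, d, e].toFinset
        edges := {{a, b, c}, {a, b, d}, {c, d, e}}
        subset_verts := by
          intro f hf
          simp only [mem_insert, mem_singleton] at hf
          rcases hf with rfl | rfl | rfl <;> intro x hx <;>
            simp only [mem_insert, mem_singleton] at hx <;>
            rcases hx with rfl | rfl | rfl <;> simp
        card_edge := by
          intro f hf
          simp only [mem_insert, mem_singleton] at hf
          rcases hf with rfl | rfl | rfl
          exacts [H.card_edge _ h₁, H.card_edge _ h₂, H.card_edge _ h₃] }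
    have hQ : Q.IsSubgraph H := by
      constructor
      · intro x hx
        have hx' : x ∈ [a, b, c, d, e] := List.mem_toFinset.1 hx
        simp only [List.mem_cons, List.not_mem_nil, or_false] at hx'
        rcases hx' with rfl | rfl | rfl | rfl | rfl
        exacts [h₁.mem.1, h₁.mem.2.1, h₁.mem.2.2, h₂.mem.2.2, h₃.mem.2.2]
      · intro f hf
        have hf' : f ∈ ({{a, b, c}, {a, b, d}, {c, d, e}} : Finset (Finset V)) := hf
        simp only [mem_insert, mem_singleton] at hf'
        rcases hf' with rfl | rfl | rfl
        exacts [h₁, h₂, h₃]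
    have hcopy : generalisedTriangle.IsCopy Q := by
      refine ⟨fun i => [a, b, c, d, e].get i, ?_, ?_, ?_⟩
      · exact (List.nodup_iff_injective_get.1 hn).injOn
      · ext x
        simp only [generalisedTriangle, Q, mem_image, mem_univ, true_and, List.mem_toFinset]
        exact List.mem_iff_get
      · simp only [generalisedTriangle, Q, image_insert, image_singleton]
        rfl
    refine ⟨insert Q 𝓕, ⟨?_, ?_⟩, ?_, ?_⟩
    · rintro P (rfl | hPF)
      exacts [⟨hQ, hcopy⟩, hF P hPF]
    · refine hP.insert fun P hPF _ => ?_
      have : Disjoint P.verts Q.verts := disjoint_of_subset_left (hsub P hPF) hd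
      exact ⟨this.symm, this⟩
    · rintro P (rfl | hPF)
      exacts [subset_union_right, (hsub P hPF).trans subset_union_left]
    · intro v hv
      rcases mem_union.1 hv with hv | hv
      · obtain ⟨P, hPF, hvP⟩ := hcov v hv
        exact ⟨P, Or.inr hPF, hvP⟩
      · exact ⟨Q, Or.inl rfl, hv⟩

theorem Tileable.hasPerfectTiling {s : Finset V} (hs : H.Tileable s) :
    HasPerfectTiling generalisedTriangle (H.induce s) := by
  obtain ⟨𝓕, ⟨hF, hP⟩, hsub, hcov⟩ := hs.exists_tiling
  refine ⟨𝓕, ⟨fun P hPF => ⟨⟨?_, ?_⟩, (hF P hPF).2⟩, hP⟩, fun v hv => hcov v (mem_inter.1 hv).2⟩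
  · exact subset_inter (hF P hPF).1.1 (hsub P hPF)
  · exact fun f hf => mem_filter.2
      ⟨(hF P hPF).1.2 hf, (P.subset_verts f hf).trans (hsub P hPF)⟩

/-- The list `l` lets one exchange `x` for `y`: both `l + x` and `l + y` can be tiled, as soon as
the entries of `l` are distinct and differ from `x` and `y`. -/
def Exchanges (H : KGraph 3 V) (x y : V) (l : List V) : Prop :=
  l.Nodup → x ∉ l → y ∉ l →
    H.Tileable (x :: l).toFinset ∧ H.Tileable (y :: l).toFinset

theorem Exchanges.symm {x y : V} {l : List V} (h : H.Exchanges x y l) : H.Exchanges y x l :=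
  fun hn hx hy => (h hn hy hx).symm

theorem Exchanges.perm {x y : V} {l l' : List V} (h : H.Exchanges x y l) (hp : l.Perm l') :
    H.Exchanges x y l' := by
  intro hn hx hy
  have := h (hp.nodup_iff.2 hn) (fun hm => hx (hp.mem_iff.1 hm)) (fun hm => hy (hp.mem_iff.1 hm))
  rwa [List.toFinset_eq_of_perm _ _ (hp.cons x), List.toFinset_eq_of_perm _ _ (hp.cons y)] at this

theorem Tileable.append {l l' : List V} (h : H.Tileable l.toFinset) (h' : H.Tileable l'.toFinset)
    (hn : (l ++ l').Nodup) : H.Tileable (l ++ l').toFinset := by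
  rw [List.toFinset_append]
  refine h.disjoint_union h' ?_
  rw [List.disjoint_toFinset_iff_disjoint]
  exact List.disjoint_of_nodup_append hn

theorem Tileable.perm {l l' : List V} (h : H.Tileable l.toFinset) (hp : l.Perm l') :
    H.Tileable l'.toFinset := by
  rwa [← List.toFinset_eq_of_perm _ _ hp]

/-- The intermediate vertex `z` joins the list: with `x` present it is tiled with `l'`, with `y`
present it is tiled with `l`. -/
theorem Exchanges.trans {x y z : V} {l l' : List V} (h : H.Exchanges x z l)
    (h' : H.Exchanges z y l') : H.Exchanges x y (z :: (l ++ l')) := by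
  intro hn hx hy
  have hn' := hn
  simp only [List.nodup_cons, List.mem_append, not_or, List.nodup_append] at hn
  simp only [List.mem_cons, List.mem_append, not_or] at hx hy
  obtain ⟨h1, h2⟩ := h hn.2.1 hx.2.1 hn.1.1
  obtain ⟨h3, h4⟩ := h' hn.2.2.1 hn.1.2 hy.2.2
  constructor
  · have hp : ((x :: l) ++ (z :: l')).Perm (x :: z :: (l ++ l')) := by
      rw [List.cons_append]
      exact (List.perm_middle).cons x
    refine (h1.append h3 ?_).perm hp
    rw [hp.nodup_iff, List.nodup_cons]
    exact ⟨by simp [hx], hn'⟩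
  · have hp : ((z :: l) ++ (y :: l')).Perm (y :: z :: (l ++ l')) := by
      rw [List.cons_append]
      exact (List.perm_middle.cons z).trans (List.Perm.swap _ _ _)
    refine (h2.append h4 ?_).perm hp
    rw [hp.nodup_iff, List.nodup_cons]
    exact ⟨by simp [hy], hn'⟩

theorem Exchanges.append {x y : V} {l l' : List V} (h : H.Exchanges x y l)
    (h' : l'.Nodup → H.Tileable l'.toFinset) : H.Exchanges x y (l ++ l') := by
  intro hn hx hy
  have hnod := hn
  rw [List.nodup_append] at hn
  simp only [List.mem_append, not_or] at hx hy
  obtain ⟨h1, h2⟩ := h hn.1 hx.1 hy.1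
  refine ⟨h1.append (h' hn.2.1) ?_, h2.append (h' hn.2.1) ?_⟩
  · rw [List.cons_append, List.nodup_cons]
    exact ⟨by simp [hx], hnod⟩
  · rw [List.cons_append, List.nodup_cons]
    exact ⟨by simp [hy], hnod⟩

/-- The two vertices play the role of `a` in `abc`, `abd`, `cde`. -/
theorem exchanges_of_adj {x y b c d e : V} (hx₁ : H.Adj b c x) (hy₁ : H.Adj b c y)
    (hx₂ : H.Adj b d x) (hy₂ : H.Adj b d y) (he : H.Adj c d e) :
    H.Exchanges x y [b, c, d, e] := by
  intro hn hx hy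
  refine ⟨tileable_of_adj ?_ ?_ he (List.nodup_cons.2 ⟨hx, hn⟩),
    tileable_of_adj ?_ ?_ he (List.nodup_cons.2 ⟨hy, hn⟩)⟩
  all_goals rw [adj_rotate]; assumption

/-- The vertex `a` completes `abc`, `abd`, `cde`, and `f` completes `cdb`, `cde`, `bef`. -/
theorem exchanges_of_adj' {a b c d e f : V} (h₁ : H.Adj b c a) (h₂ : H.Adj b d a)
    (h₃ : H.Adj c d e) (h₄ : H.Adj c d b) (h₅ : H.Adj b e f) :
    H.Exchanges a f [c, d, b, e] := by
  intro hn ha hf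
  have hp : [a, b, c, d, e].Perm [a, c, d, b, e] :=
    (show [b, c, d, e].Perm [c, d, b, e] from
      (List.perm_middle (l₁ := [c, d]) (a := b) (l₂ := [e])).symm).cons a
  have hp' : [c, d, b, e, f].Perm [f, c, d, b, e] :=
    List.perm_append_singleton f [c, d, b, e]
  have hna : [a, c, d, b, e].Nodup := List.nodup_cons.2 ⟨ha, hn⟩
  have hnf : [f, c, d, b, e].Nodup := List.nodup_cons.2 ⟨hf, hn⟩
  refine ⟨(tileable_of_adj ?_ ?_ h₃ (hp.nodup_iff.2 hna)).perm hp,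
    (tileable_of_adj h₄ h₃ h₅ (hp'.nodup_iff.2 hnf)).perm hp'⟩
  all_goals rw [adj_rotate]; assumption

end KGraph

/-! ### Common links and close vertices -/

namespace KGraph

variable {V : Type u} [DecidableEq V] {H : KGraph 3 V}

/-- Every pair of distinct vertices lies in at least `(1/3 + α) n` edges. -/
def CodegreeGE (H : KGraph 3 V) (α : ℝ) : Prop :=
  ∀ u ∈ H.verts, ∀ v ∈ H.verts, u ≠ v →
    (1 / 3 + α) * H.verts.card ≤ ∑ w ∈ H.verts, indic (H.Adj u v w)

theorem codegreeGE_of_minCodegree {α : ℝ}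
    (h : (H.verts.card : ℝ) / 3 + α * H.verts.card ≤ H.minCodegree) : H.CodegreeGE α := by
  classical
  intro u hu v hv huv
  have h1 : H.minCodegree ≤ H.degree {u, v} :=
    Nat.sInf_le ⟨{u, v}, by simp [insert_subset_iff, hu, hv], card_pair huv, rfl⟩
  have h2 : H.degree {u, v} ≤ (H.verts.filter fun w => H.Adj u v w).card := by
    refine (card_le_card ?_).trans
      (card_image_le (f := fun w => ({u, v, w} : Finset V)))
    intro e he
    obtain ⟨he, hs⟩ := mem_filter.1 he
    obtain ⟨w, hw⟩ : ∃ w, e \ {u, v} = {w} := by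
      rw [← card_eq_one, card_sdiff_of_subset hs, H.card_edge e he, card_pair huv]
    have hew : ({u, v, w} : Finset V) = e := by
      have h3 := sdiff_union_of_subset hs
      rw [hw] at h3
      rw [← h3]
      ext x; simp; tauto
    refine mem_image.2 ⟨w, mem_filter.2 ⟨H.subset_verts e he ?_, ?_⟩, hew⟩
    · rw [← hew]; simp
    · unfold Adj; rwa [hew]
  rw [sum_indic_eq_card_filter]
  have h3 : (H.minCodegree : ℝ) ≤ (H.verts.filter fun w => H.Adj u v w).card := by
    exact_mod_cast h1.trans h2
  linarith

/-- The number of ordered pairs in the common link of `x` and `y`. -/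
noncomputable def commonLink (H : KGraph 3 V) (x y : V) : ℝ :=
  ∑ p ∈ H.verts, ∑ q ∈ H.verts, indic (H.Adj p q x) * indic (H.Adj p q y)

theorem commonLink_comm (x y : V) : H.commonLink x y = H.commonLink y x := by
  simp only [commonLink, mul_comm]

theorem commonLink_le (x y : V) :
    H.commonLink x y ≤ ∑ p ∈ H.verts, ∑ q ∈ H.verts, indic (H.Adj p q x) :=
  sum_le_sum fun _ _ => sum_le_sum fun _ _ =>
    mul_le_of_le_one_right (indic_nonneg _) (indic_le_one _)

theorem commonLink_le_sq (x y : V) : H.commonLink x y ≤ (H.verts.card : ℝ) ^ 2 := by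
  refine (commonLink_le x y).trans ?_
  refine (sum_le_sum fun p _ => sum_indic_le_card _ _).trans ?_
  rw [sum_const, nsmul_eq_mul, sq]

variable {α ε : ℝ}

/-- Sum the codegrees of the pairs `px` with `p ≠ x`. The missing term `p = x` costs at most half of
the surplus `α`, because `α n ≥ 2`. -/
theorem CodegreeGE.link_ge (h : H.CodegreeGE α) (hα : 0 < α) (hα' : α ≤ 1 / 3)
    (hn : 2 ≤ α * H.verts.card) {x : V} (hx : x ∈ H.verts) :
    (1 / 3 + α / 2) * (H.verts.card : ℝ) ^ 2 ≤
      ∑ p ∈ H.verts, ∑ q ∈ H.verts, indic (H.Adj p q x) := by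
  set n : ℝ := (H.verts.card : ℝ) with hnd
  have hn0 : 0 ≤ n := Nat.cast_nonneg _
  have h1 : ∑ p ∈ H.verts.erase x, (1 / 3 + α) * n ≤
      ∑ p ∈ H.verts.erase x, ∑ q ∈ H.verts, indic (H.Adj p q x) := by
    refine sum_le_sum fun p hp => ?_
    obtain ⟨hpx, hp⟩ := mem_erase.1 hp
    refine (h p hp x hx hpx).trans (sum_le_sum fun q _ => indic_mono adj_swap_right.1)
  have h2 : ∑ p ∈ H.verts.erase x, ∑ q ∈ H.verts, indic (H.Adj p q x) ≤
      ∑ p ∈ H.verts, ∑ q ∈ H.verts, indic (H.Adj p q x) :=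
    sum_le_sum_of_subset_of_nonneg (erase_subset _ _) fun p _ _ =>
      sum_nonneg fun q _ => indic_nonneg _
  rw [sum_const, nsmul_eq_mul, card_erase_of_mem hx, Nat.cast_sub (card_pos.2 ⟨x, hx⟩),
    ← hnd] at h1
  refine le_trans ?_ (h1.trans h2)
  push_cast
  nlinarith [mul_nonneg hn0 (sub_nonneg.2 hα'), mul_nonneg hn0 (sub_nonneg.2 hn)]

/-- The links of `x` and `y` share at least `ε n²` ordered pairs. -/
def Close (H : KGraph 3 V) (ε : ℝ) (x y : V) : Prop :=
  ε * (H.verts.card : ℝ) ^ 2 ≤ H.commonLink x y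

theorem Close.symm {x y : V} (h : H.Close ε x y) : H.Close ε y x := by
  unfold Close; rwa [commonLink_comm]

/-- Two of any three links meet, as each has density more than `1/3`. -/
theorem CodegreeGE.close_or_close (h : H.CodegreeGE α) (hα : 0 < α) (hα' : α ≤ 1 / 3)
    (hn : 2 ≤ α * H.verts.card) (hε : ε ≤ α / 4) {x y z : V} (hx : x ∈ H.verts)
    (hy : y ∈ H.verts) (hz : z ∈ H.verts) :
    H.Close ε x y ∨ H.Close ε y z ∨ H.Close ε x z := by
  by_contra hcon
  simp only [Close, not_or, not_le] at hcon
  obtain ⟨c1, c2, c3⟩ := hcon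
  have l1 := h.link_ge hα hα' hn hx
  have l2 := h.link_ge hα hα' hn hy
  have l3 := h.link_ge hα hα' hn hz
  have hn0 : (0 : ℝ) < H.verts.card := by exact_mod_cast card_pos.2 ⟨x, hx⟩
  have key : (∑ p ∈ H.verts, ∑ q ∈ H.verts, indic (H.Adj p q x)) +
      (∑ p ∈ H.verts, ∑ q ∈ H.verts, indic (H.Adj p q y)) +
      (∑ p ∈ H.verts, ∑ q ∈ H.verts, indic (H.Adj p q z)) ≤
      (∑ p ∈ H.verts, ∑ q ∈ H.verts, (1 : ℝ)) + H.commonLink x y + H.commonLink y z +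
        H.commonLink x z := by
    simp only [commonLink, ← sum_add_distrib]
    refine sum_le_sum fun p _ => sum_le_sum fun q _ => ?_
    by_cases a : H.Adj p q x <;> by_cases b : H.Adj p q y <;> by_cases c : H.Adj p q z <;>
      norm_num [indic, a, b, c]
  have hone : ∑ p ∈ H.verts, ∑ q ∈ H.verts, (1 : ℝ) = (H.verts.card : ℝ) ^ 2 := by
    simp [sq]
  rw [hone] at key
  have : 0 < (H.verts.card : ℝ) ^ 2 := by positivity
  nlinarith

/-- Vertices with many common link pairs can be exchanged through many lists `[b, c, d, e]`. -/
theorem CodegreeGE.many_exchanges_of_close (h : H.CodegreeGE α) (hα : 0 < α)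
    (hε : 0 < ε) (hε' : ε ≤ 1) (hn : 4 ≤ ε * H.verts.card) {x y : V}
    (hxy : H.Close ε x y) : Many H.verts (ε / 4) 4 (H.Exchanges x y) := by
  set n : ℝ := (H.verts.card : ℝ) with hnd
  have hn0 : 0 < n := by
    by_contra hc; push Not at hc
    nlinarith
  have hb := half_mul_card_le_sum_indic (X := H.verts)
    (f := fun b => ∑ c ∈ H.verts, indic (H.Adj b c x ∧ H.Adj b c y)) (M := n) (β := ε) hn0
    (fun b _ => sum_indic_le_card _ _) hε.le (by
      rw [mul_assoc, ← hnd, ← sq]; simp only [indic_and]; exact hxy)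
  rw [← hnd] at hb
  refine Many.cons_of_forall (p := fun b => ε / 2 * n ≤
    ∑ c ∈ H.verts, indic (H.Adj b c x ∧ H.Adj b c y)) (le_trans (by nlinarith) hb) fun b _ hb => ?_
  refine Many.cons_of_forall (le_trans (by nlinarith) hb) fun c hc hbc => ?_
  refine Many.cons_of_forall (p := fun d => (H.Adj b d x ∧ H.Adj b d y) ∧ d ≠ c) ?_
    fun d hd hbd => ?_
  · have h1 : ∑ d ∈ H.verts, indic (H.Adj b d x ∧ H.Adj b d y) - ∑ d ∈ H.verts, indic (d = c) ≤
        ∑ d ∈ H.verts, indic ((H.Adj b d x ∧ H.Adj b d y) ∧ d ≠ c) := by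
      rw [← sum_sub_distrib]
      exact sum_le_sum fun d _ => indic_sub_le _ _
    have h2 := sum_indic_eq_le_one H.verts c
    rw [← hnd]
    linarith
  · refine Many.cons_of_forall (p := fun e => H.Adj c d e) (le_trans ?_ (h c hc d hd hbd.2.symm))
      fun e _ he => ?_
    · rw [← hnd]; nlinarith
    · exact exchanges_of_adj hbc.1 hbc.2 hbd.1.1 hbd.1.2 he

/-- Each vertex has at least `n / 3` close partners. -/
theorem CodegreeGE.card_close_ge (h : H.CodegreeGE α) (hα : 0 < α) (hα' : α ≤ 1 / 3)
    (hn : 2 ≤ α * H.verts.card) (hε₀ : 0 ≤ ε) (hε : ε ≤ α / 4) {y : V} (hy : y ∈ H.verts) :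
    (H.verts.card : ℝ) / 3 ≤ ∑ z ∈ H.verts, indic (H.Close ε y z) := by
  set n : ℝ := (H.verts.card : ℝ) with hnd
  have hn0 : 0 < n := by rw [hnd]; exact_mod_cast card_pos.2 ⟨y, hy⟩
  have hL := h.link_ge hα hα' hn hy
  rw [← hnd] at hL
  set L := ∑ p ∈ H.verts, ∑ q ∈ H.verts, indic (H.Adj p q y) with hLd
  -- Double counting: the common links of `y` with all `z` add up to the codegrees of the pairs in
  -- the link of `y`.
  have h1 : (1 / 3 + α) * n * L ≤ ∑ z ∈ H.verts, H.commonLink y z := by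
    have e1 : ∑ z ∈ H.verts, H.commonLink y z =
        ∑ p ∈ H.verts, ∑ q ∈ H.verts, indic (H.Adj p q y) *
          ∑ z ∈ H.verts, indic (H.Adj p q z) := by
      simp only [commonLink]
      rw [sum_comm]
      refine sum_congr rfl fun p _ => ?_
      rw [sum_comm]
      exact sum_congr rfl fun q _ => (mul_sum _ _ _).symm
    rw [e1, hLd, mul_sum]
    refine sum_le_sum fun p hp => ?_
    rw [mul_sum]
    refine sum_le_sum fun q hq => ?_
    by_cases ha : H.Adj p q y
    · rw [indic_of ha, one_mul, mul_one]
      exact h p hp q hq ha.ne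
    · rw [indic_of_not ha, zero_mul, mul_zero]
  have h2 : ∑ z ∈ H.verts, H.commonLink y z ≤
      ∑ z ∈ H.verts, (L * indic (H.Close ε y z) + ε * n ^ 2) := by
    refine sum_le_sum fun z _ => ?_
    by_cases hc : H.Close ε y z
    · rw [indic_of hc]
      have := commonLink_le (H := H) y z
      have : 0 ≤ ε * n ^ 2 := by positivity
      linarith
    · rw [indic_of_not hc]
      unfold Close at hc
      push Not at hc
      linarith
  rw [sum_add_distrib, ← mul_sum, sum_const, nsmul_eq_mul, ← hnd] at h2
  have hLpos : 0 < L := lt_of_lt_of_le (by positivity) hL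
  have h3 : L * (n / 3) ≤ L * ∑ z ∈ H.verts, indic (H.Close ε y z) := by
    -- The contribution of vertices that are not close is paid for by the surplus `α n L`, as `L >
    -- n² / 3`.
    have : ε * n ^ 3 ≤ α * n * L := by
      have : α / 4 * n ^ 3 ≤ α * n * ((1 / 3 + α / 2) * n ^ 2) := by
        have : 0 ≤ α * n ^ 3 := by positivity
        have : 0 ≤ α * (α * n ^ 3) := by positivity
        nlinarith
      have h4 : ε * n ^ 3 ≤ α / 4 * n ^ 3 := by gcongr
      have h5 : α * n * ((1 / 3 + α / 2) * n ^ 2) ≤ α * n * L := by gcongr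
      linarith
    nlinarith
  exact le_of_mul_le_mul_left h3 hLpos

end KGraph

/-! ### Two nearly covering parts with small common links across -/

theorem sum_le_sum_add_sum_of_cover {V : Type u} [DecidableEq V] {X A C : Finset V} {δ : ℝ}
    (hA : A ⊆ X) (hC : C ⊆ X) (hAC : Disjoint A C)
    (hcov : ((X \ (A ∪ C)).card : ℝ) ≤ δ) (f : V → ℝ) (hf : ∀ v, f v ≤ 1) :
    ∑ v ∈ X, f v ≤ ∑ v ∈ A, f v + ∑ v ∈ C, f v + δ := by
  rw [← sum_union hAC, ← sum_sdiff (union_subset hA hC)]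
  have : ∑ v ∈ X \ (A ∪ C), f v ≤ (X \ (A ∪ C)).card :=
    (sum_le_sum fun v _ => hf v).trans (by simp)
  linarith

namespace KGraph

variable {V : Type u} [DecidableEq V] {H : KGraph 3 V} {α : ℝ} {A C : Finset V}

/-- The number of common neighbours of the pairs `bu` and `bv`. -/
noncomputable def pairCommon (H : KGraph 3 V) (b u v : V) : ℝ :=
  ∑ w ∈ H.verts, indic (H.Adj b u w) * indic (H.Adj b v w)

/-- The number of neighbours of the pair `uv` in `C`. -/
noncomputable def codegreeIn (H : KGraph 3 V) (C : Finset V) (u v : V) : ℝ :=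
  ∑ w ∈ C, indic (H.Adj u v w)

theorem codegreeIn_comm (u v : V) : H.codegreeIn C u v = H.codegreeIn C v u := by
  simp only [codegreeIn, adj_swap_left (u := u)]

theorem sum_pairCommon (u v : V) : ∑ b ∈ H.verts, H.pairCommon b u v = H.commonLink u v := by
  simp only [pairCommon, commonLink]
  refine sum_congr rfl fun b _ => sum_congr rfl fun w _ => ?_
  rw [adj_swap_right (v := u), adj_swap_right (v := v)]

/-- Both sides count quadruples `p, q, u, v` with `u ∈ A`, `v ∈ C` and edges `pqu`, `pqv`. -/
theorem sum_codegreeIn_mul_codegreeIn :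
    ∑ p ∈ H.verts, ∑ q ∈ H.verts, H.codegreeIn A p q * H.codegreeIn C p q =
      ∑ u ∈ A, ∑ v ∈ C, H.commonLink u v := by
  have h1 : ∀ p q, H.codegreeIn A p q * H.codegreeIn C p q =
      ∑ u ∈ A, ∑ v ∈ C, indic (H.Adj p q u) * indic (H.Adj p q v) := fun p q => by
    rw [codegreeIn, codegreeIn, sum_mul_sum]
  simp only [h1, commonLink]
  calc _ = ∑ p ∈ H.verts, ∑ u ∈ A, ∑ q ∈ H.verts, ∑ v ∈ C,
        indic (H.Adj p q u) * indic (H.Adj p q v) := sum_congr rfl fun p _ => sum_comm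
    _ = ∑ u ∈ A, ∑ p ∈ H.verts, ∑ q ∈ H.verts, ∑ v ∈ C,
        indic (H.Adj p q u) * indic (H.Adj p q v) := sum_comm
    _ = ∑ u ∈ A, ∑ p ∈ H.verts, ∑ v ∈ C, ∑ q ∈ H.verts,
        indic (H.Adj p q u) * indic (H.Adj p q v) :=
          sum_congr rfl fun u _ => sum_congr rfl fun p _ => sum_comm
    _ = _ := sum_congr rfl fun u _ => sum_comm

/-- If `Σ commonLink` over `A × C` is small, then few triples `(b, u, v)` with `u ∈ A`, `v ∈ C`
have many common neighbours of `bu` and `bv`. -/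
theorem sum_indic_pairCommon_le (hA : A ⊆ H.verts) (hC : C ⊆ H.verts) {t : ℝ} :
    t * ∑ b ∈ H.verts, ∑ u ∈ H.verts, ∑ v ∈ H.verts,
        indic (u ∈ A ∧ v ∈ C ∧ t ≤ H.pairCommon b u v) ≤
      ∑ u ∈ A, ∑ v ∈ C, H.commonLink u v := by
  have h1 : ∀ b, ∑ u ∈ H.verts, ∑ v ∈ H.verts,
      indic (u ∈ A ∧ v ∈ C ∧ t ≤ H.pairCommon b u v) =
      ∑ u ∈ A, ∑ v ∈ C, indic (t ≤ H.pairCommon b u v) := fun b => by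
    rw [← sum_subset hA fun u _ hu => sum_eq_zero fun v _ => indic_of_not fun h => hu h.1]
    refine sum_congr rfl fun u hu => ?_
    rw [← sum_subset hC fun v _ hv => indic_of_not fun h => hv h.2.1]
    refine sum_congr rfl fun v hv => ?_
    simp only [hu, hv, true_and]
  have h2 : ∑ u ∈ A, ∑ v ∈ C, H.commonLink u v =
      ∑ b ∈ H.verts, ∑ u ∈ A, ∑ v ∈ C, H.pairCommon b u v := by
    simp only [← sum_pairCommon]
    rw [sum_comm]
    refine (sum_congr rfl fun u _ => sum_comm).trans ?_
    rw [sum_comm]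
    exact sum_congr rfl fun b _ => sum_comm
  rw [h2, mul_sum]
  refine sum_le_sum fun b _ => ?_
  rw [h1, mul_sum]
  refine sum_le_sum fun u _ => ?_
  rw [mul_sum]
  refine sum_le_sum fun v _ => ?_
  by_cases h : t ≤ H.pairCommon b u v
  · rwa [indic_of h, mul_one]
  · rw [indic_of_not h, mul_zero]
    exact sum_nonneg fun w _ => mul_nonneg (indic_nonneg _) (indic_nonneg _)

/-- If `Σ commonLink` over `A × C` is small, then for most pairs `bc` with `b ∈ C`, `c ∈ A` the
neighbourhood of `bc` almost misses `A` or almost misses `C`. -/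
theorem card_mul_card_le_of_codegreeIn {t : ℝ} (ht : 0 ≤ t) (hA : A ⊆ H.verts)
    (hC : C ⊆ H.verts) :
    t ^ 2 * ((A.card : ℝ) * C.card) ≤
      t ^ 2 * (∑ b ∈ C, ∑ c ∈ A, indic (H.codegreeIn C b c < t) +
        ∑ b ∈ C, ∑ c ∈ A, indic (H.codegreeIn A b c < t)) +
      ∑ u ∈ A, ∑ v ∈ C, H.commonLink u v := by
  have hcn : ∀ (D : Finset V) (p q : V), 0 ≤ H.codegreeIn D p q := fun D p q =>
    sum_nonneg fun w _ => indic_nonneg _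
  have h1 : ∑ b ∈ C, ∑ c ∈ A, H.codegreeIn A b c * H.codegreeIn C b c ≤
      ∑ u ∈ A, ∑ v ∈ C, H.commonLink u v := by
    rw [← sum_codegreeIn_mul_codegreeIn]
    refine (sum_le_sum_of_subset_of_nonneg hC fun p _ _ =>
      sum_nonneg fun q _ => mul_nonneg (hcn _ _ _) (hcn _ _ _)).trans ?_
    exact sum_le_sum fun p _ => sum_le_sum_of_subset_of_nonneg hA fun q _ _ =>
      mul_nonneg (hcn _ _ _) (hcn _ _ _)
  refine le_trans ?_ (add_le_add_right h1 _)
  have h2 : t ^ 2 * ((A.card : ℝ) * C.card) = ∑ b ∈ C, ∑ c ∈ A, t ^ 2 := by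
    simp; ring
  rw [h2, mul_add, mul_sum, mul_sum, ← sum_add_distrib, ← sum_add_distrib]
  refine sum_le_sum fun b _ => ?_
  rw [mul_sum, mul_sum, ← sum_add_distrib, ← sum_add_distrib]
  refine sum_le_sum fun c _ => ?_
  have hp := mul_nonneg (hcn A b c) (hcn C b c)
  have ht2 : 0 ≤ t ^ 2 := sq_nonneg t
  by_cases k1 : H.codegreeIn C b c < t
  · rw [indic_of k1]
    nlinarith [indic_nonneg (H.codegreeIn A b c < t)]
  by_cases k2 : H.codegreeIn A b c < t
  · rw [indic_of k2]
    nlinarith [indic_nonneg (H.codegreeIn C b c < t)]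
  rw [indic_of_not k1, indic_of_not k2]
  push Not at k1 k2
  nlinarith [mul_le_mul k2 k1 ht (hcn A b c)]

/-- A quadruple `c, d ∈ A`, `b, e ∈ C` with edges `bcd`, `ecd` such that many `a ∈ A` complete
`abc`, `abd` and many `f ∈ C` complete `bef`. -/
structure CrossBase (H : KGraph 3 V) (α : ℝ) (A C : Finset V) (c d b e : V) : Prop where
  adj_b : H.Adj c d b
  adj_e : H.Adj c d e
  many_a : α * H.verts.card ≤ ∑ a ∈ A, indic (H.Adj b c a ∧ H.Adj b d a)
  many_f : α * H.verts.card ≤ ∑ f ∈ C, indic (H.Adj b e f)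

/-- The neighbourhoods of `bc`, `bd`, `be` all have density above 1/3 and the third almost misses
the other two, so the first two must overlap. The overlap lies mostly in `A`, since `bc` has few
neighbours in `C`. -/
theorem CodegreeGE.crossBase (h : H.CodegreeGE α) (hα : 0 < α) (hA : A ⊆ H.verts)
    (hC : C ⊆ H.verts) (hAC : Disjoint A C)
    (hcov : ((H.verts \ (A ∪ C)).card : ℝ) ≤ α / 8 * H.verts.card)
    (hCcard : (1 / 3 - α / 8) * H.verts.card ≤ C.card) {b c d e : V} (hb : b ∈ C) (he : e ∈ C)
    (hc : c ∈ A) (hd : d ∈ A) (hbe : b ≠ e) (hbcd : H.Adj b c d) (hecd : H.Adj e c d)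
    (hcol : H.codegreeIn C b c < α / 8 * H.verts.card)
    (hK : H.pairCommon b c e < α / 8 * H.verts.card)
    (hK' : H.pairCommon b d e < α / 8 * H.verts.card) : H.CrossBase α A C c d b e := by
  set n : ℝ := (H.verts.card : ℝ) with hnd
  have hn0 : 0 ≤ n := Nat.cast_nonneg _
  have hαn : 0 ≤ α * n := by positivity
  have dbc := h b (hC hb) c (hA hc) hbcd.ne
  have dbd := h b (hC hb) d (hA hd) hbcd.ne_left
  have dbe := h b (hC hb) e (hC he) hbe
  rw [← hnd] at dbc dbd dbe
  have cov := fun f hf => sum_le_sum_add_sum_of_cover hA hC hAC hcov (f := f) hf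
  refine ⟨(adj_rotate (H := H)).1 hbcd, adj_rotate.1 hecd, ?_, ?_⟩
  · have h1 : ∑ w ∈ H.verts, indic (H.Adj b c w) + ∑ w ∈ H.verts, indic (H.Adj b d w) +
        ∑ w ∈ H.verts, indic (H.Adj b e w) ≤ ∑ w ∈ H.verts, (1 : ℝ) + H.pairCommon b c e +
        H.pairCommon b d e + ∑ w ∈ H.verts, indic (H.Adj b c w ∧ H.Adj b d w) := by
      simp only [pairCommon, ← sum_add_distrib]
      refine sum_le_sum fun w _ => ?_
      by_cases k1 : H.Adj b c w <;> by_cases k2 : H.Adj b d w <;> by_cases k3 : H.Adj b e w <;>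
        norm_num [indic, k1, k2, k3]
    have h2 := cov (fun w => indic (H.Adj b c w ∧ H.Adj b d w)) fun w => indic_le_one _
    have h3 : ∑ w ∈ C, indic (H.Adj b c w ∧ H.Adj b d w) ≤ H.codegreeIn C b c :=
      sum_le_sum fun w _ => indic_mono And.left
    have h4 : ∑ w ∈ H.verts, (1 : ℝ) = n := by simp [hnd]
    linarith
  -- The pair `bc` fills more than `n / 3` of `A`, and `A` has at most about `2n / 3` vertices. As
  -- `be` almost avoids the neighbours of `bc`, fewer than `n / 3` of its neighbours fit into `A`;
  -- the surplus falls in `C`.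
  · have h1 := cov (fun w => indic (H.Adj b e w)) fun w => indic_le_one _
    have h2 := cov (fun w => indic (H.Adj b c w)) fun w => indic_le_one _
    have h3 : ∑ w ∈ A, indic (H.Adj b e w) + ∑ w ∈ A, indic (H.Adj b c w) ≤
        ∑ w ∈ A, (1 : ℝ) + ∑ w ∈ A, indic (H.Adj b c w) * indic (H.Adj b e w) := by
      simp only [← sum_add_distrib]
      refine sum_le_sum fun w _ => ?_
      by_cases k1 : H.Adj b c w <;> by_cases k3 : H.Adj b e w <;> norm_num [indic, k1, k3]
    have h4 : ∑ w ∈ A, indic (H.Adj b c w) * indic (H.Adj b e w) ≤ H.pairCommon b c e :=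
      sum_le_sum_of_subset_of_nonneg hA fun w _ _ => mul_nonneg (indic_nonneg _) (indic_nonneg _)
    have h5 : (A.card : ℝ) + C.card ≤ n := by
      rw [hnd, ← Nat.cast_add, ← card_union_of_disjoint hAC]
      exact_mod_cast card_le_card (union_subset hA hC)
    have h6 : ∑ w ∈ A, (1 : ℝ) = A.card := by simp
    unfold codegreeIn at hcol
    linarith

/-- The triple `bcd` is an edge with `b ∈ C` and `c, d ∈ A`, and `bc` has few neighbours in `C`. -/
def IsBase (H : KGraph 3 V) (t : ℝ) (A C : Finset V) (b c d : V) : Prop :=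
  b ∈ C ∧ c ∈ A ∧ d ∈ A ∧ H.Adj b c d ∧ H.codegreeIn C b c < t

/-- A pair `bc` with few neighbours in `C` has at least `n / 3` neighbours `d` in `A`: the surplus
`α n` covers those in `C` and those outside both parts. -/
theorem CodegreeGE.sum_isBase_ge (h : H.CodegreeGE α) (hα : 0 < α) (hA : A ⊆ H.verts)
    (hC : C ⊆ H.verts) (hAC : Disjoint A C)
    (hcov : ((H.verts \ (A ∪ C)).card : ℝ) ≤ α / 8 * H.verts.card) :
    (H.verts.card : ℝ) / 3 *
        ∑ b ∈ C, ∑ c ∈ A, indic (H.codegreeIn C b c < α / 8 * H.verts.card) ≤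
      ∑ c ∈ H.verts, ∑ d ∈ H.verts, ∑ b ∈ H.verts,
        indic (H.IsBase (α / 8 * H.verts.card) A C b c d) := by
  set n : ℝ := (H.verts.card : ℝ) with hnd
  have e1 : ∑ c ∈ H.verts, ∑ d ∈ H.verts, ∑ b ∈ H.verts, indic (H.IsBase (α / 8 * n) A C b c d) =
      ∑ b ∈ H.verts, ∑ c ∈ H.verts, ∑ d ∈ H.verts, indic (H.IsBase (α / 8 * n) A C b c d) := by
    exact (sum_congr rfl fun c _ => sum_comm).trans sum_comm
  rw [e1, mul_sum]
  have hn0 : 0 ≤ n := Nat.cast_nonneg _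
  refine le_trans (sum_le_sum fun b hb => ?_) (sum_le_sum_of_subset_of_nonneg hC
    fun b _ _ => sum_nonneg fun c _ => sum_nonneg fun d _ => indic_nonneg _)
  rw [mul_sum]
  refine le_trans (sum_le_sum fun c hc => ?_) (sum_le_sum_of_subset_of_nonneg hA
    fun c _ _ => sum_nonneg fun d _ => indic_nonneg _)
  refine le_trans ?_ (sum_le_sum_of_subset_of_nonneg hA fun d _ _ => indic_nonneg _)
  by_cases hcol : H.codegreeIn C b c < α / 8 * n
  · have h1 : ∑ d ∈ A, indic (H.IsBase (α / 8 * n) A C b c d) = ∑ d ∈ A, indic (H.Adj b c d) :=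
      sum_congr rfl fun d hd => by simp only [IsBase, hb, hc, hd, hcol, true_and, and_true]
    have hbc : b ≠ c := fun hbc => disjoint_left.1 hAC hc (hbc ▸ hb)
    have h2 := h b (hC hb) c (hA hc) hbc
    have h3 := sum_le_sum_add_sum_of_cover hA hC hAC hcov (f := fun d => indic (H.Adj b c d))
      fun d => indic_le_one _
    have : 0 ≤ α * n := by positivity
    rw [h1, indic_of hcol]
    unfold codegreeIn at hcol
    linarith
  · rw [indic_of_not hcol, mul_zero]
    exact sum_nonneg fun d _ => indic_nonneg _

/-- There are many quadruples as in `CrossBase`. -/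
theorem CodegreeGE.many_crossBase (h : H.CodegreeGE α) (hα : 0 < α) (hα' : α ≤ 1 / 3)
    (hn : 1000000 ≤ (H.verts.card : ℝ)) (hA : A ⊆ H.verts)
    (hC : C ⊆ H.verts) (hAC : Disjoint A C)
    (hcov : ((H.verts \ (A ∪ C)).card : ℝ) ≤ α / 8 * H.verts.card)
    (hCcard : (1 / 3 - α / 8) * H.verts.card ≤ C.card)
    (hsum : ∑ u ∈ A, ∑ v ∈ C, H.commonLink u v ≤
      (α / 8) ^ 2 / 100000 * (H.verts.card : ℝ) ^ 4)
    (hcol : (H.verts.card : ℝ) ^ 2 / 40 ≤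
      ∑ b ∈ C, ∑ c ∈ A, indic (H.codegreeIn C b c < α / 8 * H.verts.card)) :
    Many H.verts (1 / 640000) 4 fun l => ∃ c d b e, l = [c, d, b, e] ∧
      H.CrossBase α A C c d b e := by
  set n : ℝ := (H.verts.card : ℝ) with hnd
  have hn0 : 0 < n := by linarith
  have hne : H.verts.Nonempty := by
    rw [← card_pos]; exact_mod_cast hnd ▸ hn0
  set t := α / 8 * n with ht
  have ht0 : 0 < t := by positivity
  set w : V × V → ℝ := fun x => ∑ b ∈ H.verts, indic (H.IsBase t A C b x.1 x.2) with hw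
  have hW : n ^ 3 / 120 ≤ ∑ x ∈ H.verts ×ˢ H.verts, w x := by
    rw [sum_product]
    refine le_trans ?_ (h.sum_isBase_ge hα hA hC hAC hcov)
    rw [← hnd]
    nlinarith [mul_le_mul_of_nonneg_left hcol (show 0 ≤ n / 3 by positivity)]
  -- Cauchy–Schwarz over pairs `(c, d)`: the sum of `w ^ 2` counts the quadruples in which both `b`
  -- and `e` form a base with `c, d`.
  have hW2 : n ^ 4 / 14400 ≤ ∑ x ∈ H.verts ×ˢ H.verts, w x ^ 2 := by
    have h1 := sq_sum_le_card_mul_sum_sq (s := H.verts ×ˢ H.verts) (f := w)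
    rw [card_product, Nat.cast_mul, ← hnd] at h1
    have h2 : (n ^ 3 / 120) ^ 2 ≤ (∑ x ∈ H.verts ×ˢ H.verts, w x) ^ 2 :=
      pow_le_pow_left₀ (by positivity) hW 2
    have h3 : n * n * (n ^ 4 / 14400) ≤ n * n * ∑ x ∈ H.verts ×ˢ H.verts, w x ^ 2 := by
      refine le_trans (le_of_eq ?_) (h2.trans h1)
      ring
    exact le_of_mul_le_mul_left h3 (by positivity)
  set K : V → V → V → ℝ := fun b u v => indic (u ∈ A ∧ v ∈ C ∧ t ≤ H.pairCommon b u v) with hK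
  set κ := ∑ b ∈ H.verts, ∑ u ∈ H.verts, ∑ v ∈ H.verts, K b u v with hκ
  have hκle : κ ≤ n ^ 3 / 100000 := by
    have h1 := (sum_indic_pairCommon_le (H := H) hA hC (t := t)).trans hsum
    have h2 : t * κ ≤ t * (α / 8 * n ^ 3 / 100000) := by
      refine h1.trans (le_of_eq ?_)
      rw [ht]; ring
    have h3 := le_of_mul_le_mul_left h2 ht0
    have : 0 ≤ n ^ 3 := by positivity
    nlinarith
  have e1 : ∑ x ∈ H.verts ×ˢ H.verts, w x ^ 2 = ∑ c ∈ H.verts, ∑ d ∈ H.verts, ∑ b ∈ H.verts,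
      ∑ e ∈ H.verts, indic (H.IsBase t A C b c d) * indic (H.IsBase t A C e c d) := by
    rw [sum_product]
    refine sum_congr rfl fun c _ => sum_congr rfl fun d _ => ?_
    rw [hw, sq, sum_mul_sum]
  have e2 : ∑ c ∈ H.verts, ∑ d ∈ H.verts, ∑ b ∈ H.verts, ∑ e ∈ H.verts, K b c e = n * κ := by
    rw [sum_comm]
    simp only [sum_const, nsmul_eq_mul, ← hnd]
    rw [sum_comm]
  have e3 : ∑ c ∈ H.verts, ∑ d ∈ H.verts, ∑ b ∈ H.verts, ∑ e ∈ H.verts, K b d e = n * κ := by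
    simp only [sum_const, nsmul_eq_mul, ← hnd]
    rw [sum_comm]
  have e4 : ∑ c ∈ H.verts, ∑ d ∈ H.verts, ∑ b ∈ H.verts, ∑ e ∈ H.verts, indic (e = b) ≤
      n ^ 3 := by
    refine (sum_le_sum fun c _ => sum_le_sum fun d _ => sum_le_sum fun b _ =>
      sum_indic_eq_le_one H.verts b).trans (le_of_eq ?_)
    simp only [sum_const, nsmul_eq_mul, ← hnd]
    ring
  -- A quadruple counted by `w ^ 2` is a `CrossBase` unless `bc, be` or `bd, be` have many common
  -- neighbours, or `e = b`.
  have key : ∑ x ∈ H.verts ×ˢ H.verts, w x ^ 2 ≤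
      (∑ c ∈ H.verts, ∑ d ∈ H.verts, ∑ b ∈ H.verts, ∑ e ∈ H.verts, K b c e) +
      (∑ c ∈ H.verts, ∑ d ∈ H.verts, ∑ b ∈ H.verts, ∑ e ∈ H.verts, K b d e) +
      (∑ c ∈ H.verts, ∑ d ∈ H.verts, ∑ b ∈ H.verts, ∑ e ∈ H.verts, indic (e = b)) +
      listCount H.verts 4 fun l => ∃ c d b e, l = [c, d, b, e] ∧ H.CrossBase α A C c d b e := by
    rw [e1]
    simp only [listCount, ← sum_add_distrib]
    refine sum_le_sum fun c _ => sum_le_sum fun d _ => sum_le_sum fun b _ =>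
      sum_le_sum fun e _ => ?_
    rw [← indic_and]
    have k1 := indic_nonneg (c ∈ A ∧ e ∈ C ∧ t ≤ H.pairCommon b c e)
    have k2 := indic_nonneg (d ∈ A ∧ e ∈ C ∧ t ≤ H.pairCommon b d e)
    have k3 := indic_nonneg (e = b)
    have k4 := indic_nonneg (∃ c' d' b' e', [c, d, b, e] = [c', d', b', e'] ∧
      H.CrossBase α A C c' d' b' e')
    by_cases hQ : H.IsBase t A C b c d ∧ H.IsBase t A C e c d
    swap
    · rw [indic_of_not hQ]; positivity
    rw [indic_of hQ]
    obtain ⟨⟨hb, hc, hd, hbcd, hcolb⟩, he, -, -, hecd, -⟩ := hQ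
    by_cases l1 : t ≤ H.pairCommon b c e
    · have : K b c e = 1 := indic_of ⟨hc, he, l1⟩
      linarith
    by_cases l2 : t ≤ H.pairCommon b d e
    · have : K b d e = 1 := indic_of ⟨hd, he, l2⟩
      linarith
    by_cases l3 : e = b
    · rw [indic_of l3]; linarith
    push Not at l1 l2
    have hcr := h.crossBase hα hA hC hAC hcov hCcard hb he hc hd (Ne.symm l3) hbcd hecd hcolb l1 l2
    rw [indic_of (p := ∃ c' d' b' e', [c, d, b, e] = [c', d', b', e'] ∧
      H.CrossBase α A C c' d' b' e') ⟨c, d, b, e, rfl, hcr⟩]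
    linarith
  rw [e2, e3] at key
  -- The balance is `1/14400 - 2/100000 - 1/1000000 ≥ 1/40000`; passing to `Many` then divides by `2
  -- ^ 4`.
  have hfin : 1 / 40000 * n ^ 4 ≤
      listCount H.verts 4 fun l => ∃ c d b e, l = [c, d, b, e] ∧ H.CrossBase α A C c d b e := by
    have h1 : n * κ ≤ n ^ 4 / 100000 := by
      have := mul_le_mul_of_nonneg_left hκle hn0.le
      linarith
    have h2 : n ^ 3 ≤ n ^ 4 / 1000000 := by
      have : 0 ≤ n ^ 3 := by positivity
      nlinarith
    have h3 : 0 ≤ n ^ 4 := by positivity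
    linarith
  have := Many.of_listCount hne (by norm_num) hfin
  norm_num at this ⊢
  exact this

end KGraph

/-! ### Exchanging two arbitrary vertices -/

namespace KGraph

variable {V : Type u} [DecidableEq V] {H : KGraph 3 V} {α β ε : ℝ} {A C : Finset V}

/-- The vertices of T are chosen greedily; `n ≥ 12` gives `n / 3 - 1 ≥ n / 4` when one earlier
vertex has to be avoided. -/
theorem CodegreeGE.many_tileable (h : H.CodegreeGE α) (hα : 0 < α)
    (hn : 12 ≤ (H.verts.card : ℝ)) :
    Many H.verts (1 / 4) 5 fun l => l.Nodup → H.Tileable l.toFinset := by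
  set n : ℝ := (H.verts.card : ℝ) with hnd
  have hαn : 0 ≤ α * n := by positivity
  refine Many.cons_of_forall (p := fun _ => True) ?_ fun a ha _ => ?_
  · simp only [indic_of, sum_const, nsmul_eq_mul, mul_one]
    linarith
  refine Many.cons_of_forall (p := fun b => True ∧ ¬ b = a) ?_ fun b hb hba => ?_
  · have h1 : ∑ b ∈ H.verts, indic True - ∑ b ∈ H.verts, indic (b = a) ≤
        ∑ b ∈ H.verts, indic (True ∧ ¬ b = a) := by
      rw [← sum_sub_distrib]
      exact sum_le_sum fun b _ => indic_sub_le _ _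
    have h2 := sum_indic_eq_le_one H.verts a
    simp only [indic_of, sum_const, nsmul_eq_mul, mul_one, ← hnd] at h1 ⊢
    linarith
  have hab := h a ha b hb (Ne.symm hba.2)
  rw [← hnd] at hab
  refine Many.cons_of_forall (p := fun c => H.Adj a b c) (by rw [← hnd]; linarith)
    fun c hc habc => ?_
  refine Many.cons_of_forall (p := fun d => H.Adj a b d ∧ ¬ d = c) ?_ fun d hd habd => ?_
  · have h1 : ∑ d ∈ H.verts, indic (H.Adj a b d) - ∑ d ∈ H.verts, indic (d = c) ≤
        ∑ d ∈ H.verts, indic (H.Adj a b d ∧ ¬ d = c) := by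
      rw [← sum_sub_distrib]
      exact sum_le_sum fun b _ => indic_sub_le _ _
    have h2 := sum_indic_eq_le_one H.verts c
    rw [← hnd]
    linarith
  have hcd := h c hc d hd (Ne.symm habd.2)
  rw [← hnd] at hcd
  refine Many.cons_of_forall (p := fun e => H.Adj c d e) (by rw [← hnd]; linarith)
    fun e _ hcde => ?_
  exact fun hnd => tileable_of_adj habc habd.1 hcde hnd

/-- Padding with a spare copy of T brings exchange lists of lengths 4 and 9 to the common length 14.
-/
theorem CodegreeGE.many_exchanges_add_five (h : H.CodegreeGE α) (hα : 0 < α) (hβ : β ≤ 1 / 4)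
    (hn : 12 ≤ (H.verts.card : ℝ)) {x y : V} {k : ℕ}
    (hm : Many H.verts β k (H.Exchanges x y)) : Many H.verts β (k + 5) (H.Exchanges x y) :=
  Many.append <| hm.mono le_rfl fun _ _ _ hl =>
    (h.many_tileable hα hn).mono hβ fun _ _ _ hl' => hl.append hl'

theorem many_exchanges_trans {p : V → Prop} {x y : V} {k k' : ℕ}
    (hp : β * H.verts.card ≤ ∑ z ∈ H.verts, indic (p z))
    (hx : ∀ z ∈ H.verts, p z → Many H.verts β k (H.Exchanges x z))
    (hy : ∀ z ∈ H.verts, p z → Many H.verts β k' (H.Exchanges z y)) :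
    Many H.verts β (k + k' + 1) (H.Exchanges x y) :=
  Many.cons_of_forall hp fun z hz hpz => Many.append <|
    (hx z hz hpz).mono le_rfl fun _ _ _ hl =>
      (hy z hz hpz).mono le_rfl fun _ _ _ hl' => hl.trans hl'

/-- The chain `x, a, f, y` uses four vertices for each of its three exchanges and the two vertices
`a`, `f`, which makes 14. The base is chosen first because the choices of `a` and `f` depend on it.
-/
theorem many_exchanges_of_crossBase (hA : A ⊆ H.verts) (hC : C ⊆ H.verts) (hβ : β ≤ α) {x y : V}
    (hx : ∀ a ∈ A, Many H.verts β 4 (H.Exchanges x a))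
    (hy : ∀ f ∈ C, Many H.verts β 4 (H.Exchanges f y))
    (hm : Many H.verts β 4 fun l => ∃ c d b e, l = [c, d, b, e] ∧ H.CrossBase α A C c d b e) :
    Many H.verts β 14 (H.Exchanges x y) := by
  refine Many.append (k := 4) (k' := 10) (hm.mono le_rfl ?_)
  rintro l - - ⟨c, d, b, e, rfl, hcr⟩
  have hcard : (0 : ℝ) ≤ H.verts.card := Nat.cast_nonneg _
  refine Many.cons_of_forall (p := fun a => a ∈ A ∧ H.Adj b c a ∧ H.Adj b d a) ?_
    fun a _ ⟨haA, ha₁, ha₂⟩ => ?_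
  · refine (mul_le_mul_of_nonneg_right hβ hcard).trans (hcr.many_a.trans ?_)
    refine (sum_le_sum fun a ha => ?_).trans
      (sum_le_sum_of_subset_of_nonneg hA fun a _ _ => indic_nonneg _)
    exact indic_mono fun h => ⟨ha, h⟩
  refine Many.cons_of_forall (p := fun f => f ∈ C ∧ H.Adj b e f) ?_ fun f _ ⟨hfC, hf⟩ => ?_
  · refine (mul_le_mul_of_nonneg_right hβ hcard).trans (hcr.many_f.trans ?_)
    refine (sum_le_sum fun f hf => ?_).trans
      (sum_le_sum_of_subset_of_nonneg hC fun f _ _ => indic_nonneg _)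
    exact indic_mono fun h => ⟨hf, h⟩
  refine Many.append (k := 4) (k' := 4) ((hx a haA).mono le_rfl fun l _ _ hl =>
    (hy f hfC).mono le_rfl fun l' _ _ hl' => ?_)
  refine (hl.trans ((exchanges_of_adj' ha₁ ha₂ hcr.adj_e hcr.adj_b hf).trans hl')).perm ?_
  rw [List.perm_iff_count]
  intro v
  simp only [List.count_cons, List.count_append, List.count_nil]
  omega

/-- Many cross pairs have few neighbours in `C`, or many have few in `A`. The second case is the
first with `A, x` and `C, y` interchanged. -/
theorem CodegreeGE.many_exchanges_of_partition (h : H.CodegreeGE α) (hα : 0 < α)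
    (hα' : α ≤ 1 / 3) (hn : 1000000 ≤ (H.verts.card : ℝ)) (hA : A ⊆ H.verts) (hC : C ⊆ H.verts)
    (hAC : Disjoint A C) (hcov : ((H.verts \ (A ∪ C)).card : ℝ) ≤ α / 8 * H.verts.card)
    (hAcard : (1 / 3 - α / 8) * H.verts.card ≤ A.card)
    (hCcard : (1 / 3 - α / 8) * H.verts.card ≤ C.card)
    (hsum : ∑ u ∈ A, ∑ v ∈ C, H.commonLink u v ≤
      (α / 8) ^ 2 / 100000 * (H.verts.card : ℝ) ^ 4)
    (hβ : β ≤ 1 / 640000) (hβα : β ≤ α) {x y : V}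
    (hx : ∀ a ∈ A, Many H.verts β 4 (H.Exchanges x a))
    (hy : ∀ f ∈ C, Many H.verts β 4 (H.Exchanges y f)) :
    Many H.verts β 14 (H.Exchanges x y) := by
  set n : ℝ := (H.verts.card : ℝ) with hnd
  have hn0 : 0 < n := by linarith
  have hcol := card_mul_card_le_of_codegreeIn (H := H) (t := α / 8 * n) (by positivity) hA hC
  -- With `t = α n / 8`, the common links sum to at most `t² n² / 100000`, while `|A| |C| ≥ n² /
  -- 16`.
  have hcol' : n ^ 2 / 20 ≤
      ∑ b ∈ C, ∑ c ∈ A, indic (H.codegreeIn C b c < α / 8 * n) +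
        ∑ b ∈ C, ∑ c ∈ A, indic (H.codegreeIn A b c < α / 8 * n) := by
    have h1 : n / 4 * (n / 4) ≤ (A.card : ℝ) * C.card := by
      refine mul_le_mul ?_ ?_ (by positivity) (by positivity) <;> nlinarith
    have h2 : 0 < (α / 8 * n) ^ 2 := by positivity
    have h3 : (α / 8 * n) ^ 2 * (n ^ 2 / 20) ≤ (α / 8 * n) ^ 2 *
      (∑ b ∈ C, ∑ c ∈ A, indic (H.codegreeIn C b c < α / 8 * n) +
        ∑ b ∈ C, ∑ c ∈ A, indic (H.codegreeIn A b c < α / 8 * n)) := by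
      have h4 := mul_le_mul_of_nonneg_left h1 h2.le
      have h5 : (α / 8) ^ 2 / 100000 * n ^ 4 = (α / 8 * n) ^ 2 * (n ^ 2 / 100000) := by ring
      rw [h5] at hsum
      have h6 : 0 ≤ (α / 8 * n) ^ 2 * n ^ 2 := by positivity
      linarith
    exact le_of_mul_le_mul_left h3 h2
  have hsymm : ∀ {u v : V} {k : ℕ}, Many H.verts β k (H.Exchanges u v) →
      Many H.verts β k (H.Exchanges v u) := fun hm => hm.mono le_rfl fun _ _ _ hl => hl.symm
  rcases le_or_gt (n ^ 2 / 40) (∑ b ∈ C, ∑ c ∈ A, indic (H.codegreeIn C b c < α / 8 * n))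
    with hc | hc
  · exact many_exchanges_of_crossBase hA hC hβα hx (fun f hf => hsymm (hy f hf))
      ((h.many_crossBase hα hα' hn hA hC hAC hcov hCcard hsum hc).mono hβ fun _ _ _ hl => hl)
  · have hc' : n ^ 2 / 40 ≤ ∑ b ∈ A, ∑ c ∈ C, indic (H.codegreeIn A b c < α / 8 * n) := by
      have e : ∑ b ∈ A, ∑ c ∈ C, indic (H.codegreeIn A b c < α / 8 * n) =
          ∑ b ∈ C, ∑ c ∈ A, indic (H.codegreeIn A b c < α / 8 * n) := by
        rw [sum_comm]
        exact sum_congr rfl fun b _ => sum_congr rfl fun c _ => by rw [codegreeIn_comm]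
      linarith
    have hsum' : ∑ u ∈ C, ∑ v ∈ A, H.commonLink u v ≤ (α / 8) ^ 2 / 100000 * n ^ 4 := by
      rw [sum_comm]
      refine le_trans (le_of_eq ?_) hsum
      exact sum_congr rfl fun b _ => sum_congr rfl fun c _ => commonLink_comm _ _
    exact hsymm (many_exchanges_of_crossBase hC hA hβα hy (fun f hf => hsymm (hx f hf))
      ((h.many_crossBase hα hα' hn hC hA hAC.symm (by rwa [union_comm]) hAcard hsum' hc').mono hβ
        fun _ _ _ hl => hl))

/-- Any two vertices can be exchanged through many lists of length `14`. -/
theorem CodegreeGE.many_exchanges (h : H.CodegreeGE α) (hα : 0 < α) (hα' : α ≤ 1 / 3)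
    (hε : ε = α ^ 2 / 12800000) (hn : 4 ≤ ε * H.verts.card) {x y : V} (hx : x ∈ H.verts)
    (hy : y ∈ H.verts) : Many H.verts (ε / 4) 14 (H.Exchanges x y) := by
  classical
  set n : ℝ := (H.verts.card : ℝ) with hnd
  have hε0 : 0 < ε := by rw [hε]; positivity
  have hεα : ε ≤ α / 12800000 := by rw [hε]; nlinarith
  have hn0 : 0 < n := by
    by_contra hc; push Not at hc
    nlinarith
  have hαn : 51200000 ≤ α * n := by nlinarith
  have hn1 : 1000000 ≤ n := by nlinarith
  have hclose : ∀ {u v : V}, H.Close ε u v → Many H.verts (ε / 4) 4 (H.Exchanges u v) :=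
    fun huv => h.many_exchanges_of_close hα hε0 (by linarith) hn huv
  have hthree : ∀ {u v w : V}, u ∈ H.verts → v ∈ H.verts → w ∈ H.verts →
      H.Close ε u v ∨ H.Close ε v w ∨ H.Close ε u w := fun hu hv hw =>
    h.close_or_close hα hα' (by linarith) (by linarith) hu hv hw
  have hβ4 : ε / 4 ≤ 1 / 4 := by linarith
  by_cases hxy : H.Close ε x y
  · exact h.many_exchanges_add_five hα hβ4 (by linarith)
      (h.many_exchanges_add_five hα hβ4 (by linarith) (hclose hxy))
  by_cases hcommon : α / 8 * n ≤ ∑ z ∈ H.verts, indic (H.Close ε x z ∧ H.Close ε y z)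
  · refine h.many_exchanges_add_five hα hβ4 (by linarith) (k := 9)
      (many_exchanges_trans (k := 4) (k' := 4) (le_trans ?_ hcommon)
        (fun z _ hz => hclose hz.1) fun z _ hz => hclose hz.2.symm)
    rw [← hnd]; nlinarith
  -- Since `x` and `y` are not close, a third vertex that is not close to one of them is close to
  -- the other.
  set A := H.verts.filter fun z => ¬ H.Close ε y z with hAd
  set C := H.verts.filter fun z => ¬ H.Close ε x z with hCd
  have hA : A ⊆ H.verts := filter_subset _ _
  have hC : C ⊆ H.verts := filter_subset _ _
  have hxA : ∀ a ∈ A, H.Close ε x a := fun a ha => by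
    obtain ⟨ha, hya⟩ := mem_filter.1 ha
    rcases hthree hx hy ha with h1 | h1 | h1
    exacts [absurd h1 hxy, absurd h1 hya, h1]
  have hyC : ∀ f ∈ C, H.Close ε y f := fun f hf => by
    obtain ⟨hf, hxf⟩ := mem_filter.1 hf
    rcases hthree hx hy hf with h1 | h1 | h1
    exacts [absurd h1 hxy, h1, absurd h1 hxf]
  have hAC : Disjoint A C := disjoint_left.2 fun z hzA hzC => (mem_filter.1 hzC).2 (hxA z hzA)
  have hcov : ((H.verts \ (A ∪ C)).card : ℝ) ≤ α / 8 * n := by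
    have h1 : ((H.verts \ (A ∪ C)).card : ℝ) ≤
        ∑ z ∈ H.verts, indic (H.Close ε x z ∧ H.Close ε y z) := by
      rw [sum_indic_eq_card_filter]
      refine Nat.cast_le.2 (card_le_card fun z hz => ?_)
      simp only [hAd, hCd, mem_sdiff, mem_union, mem_filter, not_or, not_and, not_not] at hz ⊢
      exact ⟨hz.1, hz.2.2 hz.1, hz.2.1 hz.1⟩
    linarith
  have hcard : ∀ {u : V} (D : Finset V), u ∈ H.verts →
      (∀ z ∈ H.verts, H.Close ε u z → z ∈ D ∨ (H.Close ε x z ∧ H.Close ε y z)) →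
      D ⊆ H.verts → (1 / 3 - α / 8) * n ≤ D.card := fun {u} D hu hD hDs => by
    have h1 := h.card_close_ge hα hα' (by linarith) hε0.le (by linarith) hu
    have h2 : ∑ z ∈ H.verts, indic (H.Close ε u z) ≤ ∑ z ∈ H.verts, indic (z ∈ D) +
        ∑ z ∈ H.verts, indic (H.Close ε x z ∧ H.Close ε y z) := by
      rw [← sum_add_distrib]
      exact sum_le_sum fun z hz => (indic_mono (hD z hz)).trans (indic_or_le _ _)
    have h3 : ∑ z ∈ H.verts, indic (z ∈ D) = D.card := by
      rw [sum_indic_eq_card_filter, filter_mem_eq_inter, inter_eq_right.2 hDs]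
    rw [← hnd] at h1
    linarith
  have hCcard : (1 / 3 - α / 8) * n ≤ C.card := by
    refine hcard C hy (fun z hz hyz => ?_) hC
    by_cases hxz : H.Close ε x z
    · exact Or.inr ⟨hxz, hyz⟩
    · exact Or.inl (mem_filter.2 ⟨hz, hxz⟩)
  have hAcard : (1 / 3 - α / 8) * n ≤ A.card := by
    refine hcard A hx (fun z hz hxz => ?_) hA
    by_cases hyz : H.Close ε y z
    · exact Or.inr ⟨hxz, hyz⟩
    · exact Or.inl (mem_filter.2 ⟨hz, hyz⟩)
  -- Many close pairs across give chains `x, u, v, y` of three direct exchanges, again of total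
  -- length 14.
  by_cases hcross : ε * n * n ≤
      ∑ u ∈ H.verts, ∑ v ∈ H.verts, indic (u ∈ A ∧ v ∈ C ∧ H.Close ε u v)
  · have h1 := half_mul_card_le_sum_indic (X := H.verts) hn0
      (fun u _ => sum_indic_le_card H.verts _) hε0.le hcross
    rw [← hnd] at h1
    refine Many.mono (P := H.Exchanges x y) (many_exchanges_trans (k := 4) (k' := 9)
      (p := fun u => ε / 2 * n ≤ ∑ v ∈ H.verts, indic (u ∈ A ∧ v ∈ C ∧ H.Close ε u v))
      (le_trans ?_ h1) (fun u _ hu => ?_) fun u _ hu => ?_) le_rfl fun _ _ _ hl => hl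
    · rw [← hnd]; nlinarith
    · refine hclose (hxA u ?_)
      by_contra huA
      have : ∑ v ∈ H.verts, indic (u ∈ A ∧ v ∈ C ∧ H.Close ε u v) = 0 :=
        sum_eq_zero fun v _ => indic_of_not fun h => huA h.1
      nlinarith
    · refine many_exchanges_trans (k := 4) (k' := 4) (le_trans ?_ hu) (fun v _ hv => hclose hv.2.2)
        fun v _ hv => hclose (hyC v hv.2.1).symm
      rw [← hnd]; nlinarith
  -- Close pairs and the remaining pairs each contribute at most `ε n⁴`. The value of `ε` is chosen
  -- so that `2 ε = (α / 8)² / 100000`.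
  have hsum : ∑ u ∈ A, ∑ v ∈ C, H.commonLink u v ≤ (α / 8) ^ 2 / 100000 * n ^ 4 := by
    have h1 : ∑ u ∈ A, ∑ v ∈ C, H.commonLink u v ≤ ∑ u ∈ A, ∑ v ∈ C,
        (n ^ 2 * indic (u ∈ A ∧ v ∈ C ∧ H.Close ε u v) + ε * n ^ 2) := by
      refine sum_le_sum fun u hu => sum_le_sum fun v hv => ?_
      by_cases hc : H.Close ε u v
      · rw [indic_of ⟨hu, hv, hc⟩]
        have := commonLink_le_sq (H := H) u v
        have : 0 ≤ ε * n ^ 2 := by positivity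
        linarith
      · have := indic_nonneg (u ∈ A ∧ v ∈ C ∧ H.Close ε u v)
        have : 0 ≤ n ^ 2 * indic (u ∈ A ∧ v ∈ C ∧ H.Close ε u v) := by positivity
        unfold Close at hc
        push Not at hc
        linarith
    have hnn : ∀ u v, 0 ≤ n ^ 2 * indic (u ∈ A ∧ v ∈ C ∧ H.Close ε u v) + ε * n ^ 2 :=
      fun u v => by
        have := indic_nonneg (u ∈ A ∧ v ∈ C ∧ H.Close ε u v)
        positivity
    have h2 : ∑ u ∈ A, ∑ v ∈ C,
        (n ^ 2 * indic (u ∈ A ∧ v ∈ C ∧ H.Close ε u v) + ε * n ^ 2) ≤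
        ∑ u ∈ H.verts, ∑ v ∈ H.verts,
        (n ^ 2 * indic (u ∈ A ∧ v ∈ C ∧ H.Close ε u v) + ε * n ^ 2) :=
      (sum_le_sum fun u _ => sum_le_sum_of_subset_of_nonneg hC fun v _ _ => hnn u v).trans
        (sum_le_sum_of_subset_of_nonneg hA fun u _ _ => sum_nonneg fun v _ => hnn u v)
    simp only [sum_add_distrib, ← mul_sum, sum_const, nsmul_eq_mul, ← hnd] at h2
    push Not at hcross
    have h3 : n ^ 2 * ∑ u ∈ H.verts, ∑ v ∈ H.verts, indic (u ∈ A ∧ v ∈ C ∧ H.Close ε u v) ≤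
        n ^ 2 * (ε * n * n) := by gcongr
    simp only [sum_add_distrib, ← mul_sum, sum_const, nsmul_eq_mul] at h1
    have h4 : (α / 8) ^ 2 / 100000 * n ^ 4 = 2 * ε * n ^ 4 := by rw [hε]; ring
    rw [h4]
    linarith
  exact h.many_exchanges_of_partition hα hα' hn1 hA hC hAC hcov hAcard hCcard hsum
    (by linarith) (by linarith) (fun a ha => hclose (hxA a ha)) fun f hf => hclose (hyC f hf)

end KGraph

/-! ### Absorbing lists and the absorbing family -/

namespace KGraph

variable {V : Type u} [DecidableEq V] {H : KGraph 3 V} {α β : ℝ}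

/-- One exchange list is taken for each pair of corresponding entries of `vs` and `ws`; their
concatenation is tiled with either side. -/
theorem many_exchanges_lists {m : ℕ}
    (hex : ∀ x ∈ H.verts, ∀ y ∈ H.verts, Many H.verts β m (H.Exchanges x y)) :
    ∀ (k : ℕ) (vs ws : List V), vs.length = k → ws.length = k → (∀ v ∈ vs, v ∈ H.verts) →
      (∀ w ∈ ws, w ∈ H.verts) → Many H.verts β (m * k) fun l => (vs ++ ws ++ l).Nodup →
        H.Tileable (ws ++ l).toFinset ∧ H.Tileable (vs ++ l).toFinset
  | 0, vs, ws, hv, hw, _, _ => by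
    rw [List.length_eq_zero_iff] at hv hw
    subst hv hw
    exact fun _ => ⟨.empty, .empty⟩
  | k + 1, [], ws, hv, _, _, _ => by simp at hv
  | k + 1, vs, [], _, hw, _, _ => by simp at hw
  | k + 1, v :: vs, w :: ws, hv, hw, hvX, hwX => by
    rw [mul_add_one, add_comm]
    simp only [List.mem_cons, forall_eq_or_imp] at hvX hwX
    refine Many.append ((hex v hvX.1 w hwX.1).mono le_rfl fun l _ _ hl => ?_)
    refine (many_exchanges_lists hex k vs ws (by simpa using hv) (by simpa using hw) hvX.2
      hwX.2).mono le_rfl fun l' _ _ hl' hn => ?_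
    have hp : ∀ (x : V) (xs : List V), ((x :: l) ++ (xs ++ l')).Perm ((x :: xs) ++ (l ++ l')) := by
      intro x xs
      rw [List.perm_iff_count]
      intro z
      simp only [List.count_cons, List.count_append]
      omega
    have hnv : ((v :: vs) ++ (l ++ l')).Nodup :=
      hn.sublist ((List.sublist_append_left _ _).append_right _)
    have hnw : ((w :: ws) ++ (l ++ l')).Nodup :=
      hn.sublist ((List.sublist_append_right _ _).append_right _)
    have hvl := ((hp v vs).nodup_iff.2 hnv).of_append_left
    have hwl := ((hp w ws).nodup_iff.2 hnw).of_append_left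
    rw [List.nodup_cons] at hvl hwl
    obtain ⟨h1, h2⟩ := hl hvl.2 hvl.1 hwl.1
    obtain ⟨h3, h4⟩ := hl' (hn.sublist (((List.sublist_cons_self _ _).append
      (List.sublist_cons_self _ _)).append (List.sublist_append_right _ _)))
    exact ⟨(h2.append h3 ((hp w ws).nodup_iff.2 hnw)).perm (hp w ws),
      (h1.append h4 ((hp v vs).nodup_iff.2 hnv)).perm (hp v vs)⟩

/-- Every `5`-set of vertices has many absorbing lists. -/
theorem CodegreeGE.many_absorbing (h : H.CodegreeGE α) (hα : 0 < α) (hβ : β ≤ 1 / 4)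
    (hn : 12 ≤ (H.verts.card : ℝ))
    (hex : ∀ x ∈ H.verts, ∀ y ∈ H.verts, Many H.verts β 14 (H.Exchanges x y))
    {S : Finset V} (hS : S ∈ H.verts.powersetCard 5) :
    Many H.verts β 75 fun l => l.Nodup → (∀ v ∈ l, v ∉ S) →
      H.Tileable l.toFinset ∧ H.Tileable (l.toFinset ∪ S) := by
  obtain ⟨hSX, hS5⟩ := mem_powersetCard.1 hS
  -- The list consists of a copy `ws` of T and five exchange lists between `S` and `ws`, so `75 = 5
  -- + 14 * 5`.
  refine Many.append (k := 5) (k' := 14 * 5)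
    ((h.many_tileable hα hn).mono hβ fun ws hws hwX hw => ?_)
  refine (many_exchanges_lists hex 5 S.toList ws (by simpa using hS5) hws
    (fun v hv => hSX (mem_toList.1 hv)) hwX).mono le_rfl fun l _ _ hl hn hd => ?_
  have hd' : ∀ v ∈ ws ++ l, v ∉ S.toList := fun v hv hvS => hd v hv (mem_toList.1 hvS)
  have hnod : (S.toList ++ ws ++ l).Nodup := by
    rw [List.append_assoc, List.nodup_append]
    exact ⟨S.nodup_toList, hn, fun a ha b hb hab => hd' b hb (hab ▸ ha)⟩
  obtain ⟨h1, h2⟩ := hl hnod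
  refine ⟨h1, ?_⟩
  have hp : (S.toList ++ ws ++ l).Perm (ws ++ (S.toList ++ l)) := by
    rw [← List.append_assoc]
    exact List.perm_append_comm.append_right l
  have h3 := (hw hn.of_append_left).append h2 (hp.nodup_iff.1 hnod)
  have e : (ws ++ l).toFinset ∪ S = (ws ++ (S.toList ++ l)).toFinset := by
    ext v
    simp only [List.toFinset_append, toList_toFinset, mem_union]
    tauto
  rwa [e]

open Classical in
/-- The number of members of `F` that absorb `S`. -/
noncomputable def absorberCount (H : KGraph 3 V) (F : Finset (Finset V)) (S : Finset V) : ℕ :=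
  (F.filter fun t => Disjoint t S ∧ H.Tileable (t ∪ S)).card

/-- `F` consists of pairwise disjoint tileable sets of `m` vertices. -/
structure IsAbsorbingFamily (H : KGraph 3 V) (m : ℕ) (F : Finset (Finset V)) : Prop where
  subset : ∀ t ∈ F, t ⊆ H.verts
  card : ∀ t ∈ F, t.card = m
  tileable : ∀ t ∈ F, H.Tileable t
  disjoint : (F : Set (Finset V)).PairwiseDisjoint id

/-- The members of the family are chosen one by one, each so as to shrink the total weight of the
`5`-sets, where an absorber halves the weight of a `5`-set. -/
theorem exists_absorbingFamily {m : ℕ} (hm0 : 0 < m) (hβ : 0 < β) (hβ' : β ≤ 1)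
    (h5 : 5 ≤ H.verts.card)
    (hm : ∀ S ∈ H.verts.powersetCard 5, Many H.verts β m fun l => l.Nodup → (∀ v ∈ l, v ∉ S) →
      H.Tileable l.toFinset ∧ H.Tileable (l.toFinset ∪ S))
    (N : ℕ) (hN : (m : ℝ) * N + 5 ≤ β / 2 * H.verts.card) :
    ∃ F : Finset (Finset V), F.card = N ∧ H.IsAbsorbingFamily m F ∧
      ∑ S ∈ H.verts.powersetCard 5, (1 / 2 : ℝ) ^ H.absorberCount F S ≤
        (1 - (β / 2) ^ m / 2) ^ N * (H.verts.powersetCard 5).card := by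
  classical
  induction N with
  | zero =>
    refine ⟨∅, rfl, ⟨by simp, by simp, by simp, by simp⟩, ?_⟩
    simp [absorberCount]
  | succ N ih =>
    push_cast at hN
    have hm0' : (0 : ℝ) < m := by exact_mod_cast hm0
    obtain ⟨F, hFN, hF, hsum⟩ := ih (by nlinarith)
    set U := F.biUnion id with hU
    have hUcard : (U.card : ℝ) ≤ m * N := by
      have : U.card ≤ F.card * m := card_biUnion_le_card_mul _ _ _ fun t ht => (hF.card t ht).le
      rw [hFN, mul_comm] at this
      exact_mod_cast this
    have hne : H.verts.Nonempty := card_pos.1 (by omega)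
    -- One list serves a proportion `(β / 2) ^ m` of the total weight. Avoiding `U ∪ S` halves `β`;
    -- the 5 in `hN` accounts for `S`.
    obtain ⟨l, hl, hlX, hw⟩ := Many.exists_weight hne (β := β / 2) (k := m) (by positivity)
      (H.verts.powersetCard 5)
      (fun S => (1 / 2 : ℝ) ^ H.absorberCount F S) (fun S => by positivity) _
      (fun S hS => (hm S hS).avoid (U ∪ S) (by
        have h1 : ((U ∪ S).card : ℝ) ≤ U.card + S.card := by exact_mod_cast card_union_le U S
        rw [(mem_powersetCard.1 hS).2] at h1
        push_cast at h1
        linarith))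
    set P : Finset V → Prop := fun S => (l.Nodup → (∀ v ∈ l, v ∉ S) →
      H.Tileable l.toFinset ∧ H.Tileable (l.toFinset ∪ S)) ∧ l.Nodup ∧ ∀ v ∈ l, v ∉ U ∪ S with hP
    have hPS : ∀ S, P S → l.Nodup ∧ (∀ v ∈ l, v ∉ U) ∧ Disjoint l.toFinset S ∧
        H.Tileable l.toFinset ∧ H.Tileable (l.toFinset ∪ S) := by
      rintro S ⟨h1, h2, h3⟩
      have h4 : ∀ v ∈ l, v ∉ S := fun v hv hvS => h3 v hv (mem_union_right _ hvS)
      refine ⟨h2, fun v hv hvU => h3 v hv (mem_union_left _ hvU), ?_, h1 h2 h4⟩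
      exact disjoint_left.2 fun v hv => h4 v (List.mem_toFinset.1 hv)
    -- The total weight is positive, so some 5-set is served. This certifies that `l` has distinct
    -- entries, misses `U` and is tileable.
    obtain ⟨S₀, hS₀⟩ : ∃ S, P S := by
      by_contra! hno
      have h0 : ∑ S ∈ H.verts.powersetCard 5, (1 / 2 : ℝ) ^ H.absorberCount F S * indic (P S) = 0 :=
        sum_eq_zero fun S _ => by rw [indic_of_not (hno S), mul_zero]
      rw [h0] at hw
      have hpos : 0 < ∑ S ∈ H.verts.powersetCard 5, (1 / 2 : ℝ) ^ H.absorberCount F S :=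
        sum_pos (fun S _ => by positivity) (powersetCard_nonempty.2 h5)
      have : 0 < (β / 2) ^ m * ∑ S ∈ H.verts.powersetCard 5,
        (1 / 2 : ℝ) ^ H.absorberCount F S := by positivity
      linarith
    obtain ⟨hnod, hlU, -, hlT, -⟩ := hPS S₀ hS₀
    have hdisj : ∀ t ∈ F, Disjoint l.toFinset t := fun t ht => disjoint_left.2 fun v hv hvt =>
      hlU v (List.mem_toFinset.1 hv) (mem_biUnion.2 ⟨t, ht, hvt⟩)
    have hlcard : l.toFinset.card = m := by rw [List.toFinset_card_of_nodup hnod, hl]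
    have hlF : l.toFinset ∉ F := fun hlF => by
      have h1 := hdisj _ hlF
      rw [disjoint_self_iff_empty] at h1
      rw [h1, card_empty] at hlcard
      omega
    refine ⟨insert l.toFinset F, by rw [card_insert_of_notMem hlF, hFN], ⟨?_, ?_, ?_, ?_⟩, ?_⟩
    · exact forall_mem_insert _ _ _ |>.2 ⟨fun v hv => hlX v (List.mem_toFinset.1 hv), hF.subset⟩
    · exact forall_mem_insert _ _ _ |>.2 ⟨hlcard, hF.card⟩
    · exact forall_mem_insert _ _ _ |>.2 ⟨hlT, hF.tileable⟩
    · rw [coe_insert]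
      exact hF.disjoint.insert fun t ht _ => hdisj t ht
    · have hstep : ∀ S, (1 / 2 : ℝ) ^ H.absorberCount (insert l.toFinset F) S ≤
          (1 / 2 : ℝ) ^ H.absorberCount F S -
            (1 / 2 : ℝ) ^ H.absorberCount F S * indic (P S) / 2 := by
        intro S
        by_cases hS : P S
        · obtain ⟨-, -, h1, -, h2⟩ := hPS S hS
          have : H.absorberCount (insert l.toFinset F) S = H.absorberCount F S + 1 := by
            unfold absorberCount
            rw [filter_insert, if_pos ⟨h1, h2⟩, card_insert_of_notMem]
            exact fun hmem => hlF (mem_filter.1 hmem).1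
          rw [this, indic_of hS, pow_succ]
          linarith
        · rw [indic_of_not hS, mul_zero, zero_div, sub_zero]
          refine pow_le_pow_of_le_one (by norm_num) (by norm_num) (card_le_card ?_)
          exact filter_subset_filter _ (subset_insert _ _)
      have h1 := sum_le_sum fun S (_ : S ∈ H.verts.powersetCard 5) => hstep S
      rw [sum_sub_distrib, ← sum_div] at h1
      have h2 : (β / 2) ^ m ≤ 1 := by
        exact pow_le_one₀ (by positivity) (by linarith)
      have h3 := mul_le_mul_of_nonneg_left hsum (show 0 ≤ 1 - (β / 2) ^ m / 2 by linarith)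
      rw [pow_succ']
      linarith

/-- Split off five vertices of `S` and spend one of their absorbers. Every other 5-set loses at most
one absorber, so `q - 1` remain for the remaining `q - 1` rounds. Unused members are tileable by
themselves. -/
theorem tileable_of_absorberCount {m : ℕ} (q : ℕ) {F : Finset (Finset V)}
    (hF : H.IsAbsorbingFamily m F) {S : Finset V} (hS : S ⊆ H.verts) (hcard : S.card = 5 * q)
    (hd : ∀ t ∈ F, Disjoint t S)
    (hq : ∀ R ∈ H.verts.powersetCard 5, q ≤ H.absorberCount F R) :
    H.Tileable (F.biUnion id ∪ S) := by
  classical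
  induction q generalizing F S with
  | zero =>
    rw [mul_zero, card_eq_zero] at hcard
    rw [hcard, union_empty]
    clear hq hd
    induction F using Finset.induction_on with
    | empty => exact .empty
    | insert t F ht ih =>
      rw [biUnion_insert]
      refine (hF.tileable t (mem_insert_self t F)).disjoint_union (ih
        ⟨fun s hs => hF.subset s (mem_insert_of_mem hs), fun s hs => hF.card s (mem_insert_of_mem hs),
          fun s hs => hF.tileable s (mem_insert_of_mem hs),
          hF.disjoint.subset (by simp)⟩) ?_
      refine (disjoint_biUnion_right _ _ _).2 fun s hs => ?_
      exact hF.disjoint (by simp) (by simp [hs]) fun hts => ht (hts ▸ hs)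
  | succ q ih =>
    obtain ⟨R, hRS, hR⟩ := exists_subset_card_eq (show 5 ≤ S.card by omega)
    have hpos : 0 < H.absorberCount F R :=
      (Nat.succ_pos q).trans_le (hq R (mem_powersetCard.2 ⟨hRS.trans hS, hR⟩))
    obtain ⟨t, ht⟩ := card_pos.1 hpos
    obtain ⟨htF, htR, htT⟩ := mem_filter.1 ht
    have hrest : H.Tileable ((F.erase t).biUnion id ∪ (S \ R)) := by
      refine ih ⟨fun s hs => hF.subset s (mem_of_mem_erase hs),
        fun s hs => hF.card s (mem_of_mem_erase hs), fun s hs => hF.tileable s (mem_of_mem_erase hs),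
        hF.disjoint.subset (by simp)⟩ (sdiff_subset.trans hS) ?_ ?_ ?_
      · rw [card_sdiff_of_subset hRS, hcard, hR]; omega
      · exact fun s hs => disjoint_of_subset_right sdiff_subset (hd s (mem_of_mem_erase hs))
      · intro R' hR'
        have h1 := hq R' hR'
        have h2 : H.absorberCount F R' ≤ H.absorberCount (F.erase t) R' + 1 := by
          unfold absorberCount
          rw [filter_erase]
          have := pred_card_le_card_erase (s := F.filter fun t =>
            Disjoint t R' ∧ H.Tileable (t ∪ R')) (a := t)
          omega
        omega
    have e : F.biUnion id ∪ S = (F.erase t).biUnion id ∪ (S \ R) ∪ (t ∪ R) := by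
      conv_lhs => rw [← insert_erase htF, biUnion_insert, ← sdiff_union_of_subset hRS]
      ext v
      simp only [mem_union, id]
      tauto
    rw [e]
    refine hrest.disjoint_union htT ?_
    rw [disjoint_union_left, disjoint_union_right, disjoint_union_right]
    refine ⟨⟨?_, ?_⟩, (disjoint_of_subset_right sdiff_subset (hd t htF)).symm, sdiff_disjoint⟩
    · refine (disjoint_biUnion_left _ _ _).2 fun s hs => ?_
      exact hF.disjoint (mem_of_mem_erase hs) htF (ne_of_mem_erase hs)
    · refine (disjoint_biUnion_left _ _ _).2 fun s hs => ?_
      exact disjoint_of_subset_right hRS (hd s (mem_of_mem_erase hs))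

end KGraph

/-! ### Choice of constants and conclusion -/

theorem eventually_pow_lt_exp {κ : ℝ} (hκ : 0 < κ) :
    ∀ᶠ n : ℕ in Filter.atTop, (n : ℝ) ^ 5 < Real.exp (κ * n - 1) := by
  have h1 : Filter.Tendsto (fun n : ℕ => κ * (n : ℝ)) Filter.atTop Filter.atTop :=
    tendsto_natCast_atTop_atTop.const_mul_atTop hκ
  have h2 := (Real.tendsto_pow_mul_exp_neg_atTop_nhds_zero 5).comp h1
  have h3 := h2.eventually (gt_mem_nhds (show 0 < κ ^ 5 * Real.exp (-1) by positivity))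
  filter_upwards [h3] with n hn
  simp only [Function.comp] at hn
  rw [Real.exp_neg, mul_pow, ← div_eq_mul_inv, div_lt_iff₀ (Real.exp_pos _)] at hn
  rw [sub_eq_add_neg, add_comm, Real.exp_add]
  have : 0 < κ ^ 5 := by positivity
  nlinarith

theorem lemma1p4 :
    ∀ α : ℝ, 0 < α → ∃ c₀ : ℝ, 0 < c₀ ∧ ∀ c : ℝ, 0 < c → c < c₀ →
      ∃ n₀ : ℕ, ∀ n : ℕ, n₀ ≤ n →
        ∀ (V : Type*) [DecidableEq V] (H : KGraph 3 V), H.verts.card = n →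
          (n : ℝ) / 3 + α * n ≤ (H.minCodegree : ℝ) →
          ∃ A : Finset V, A ⊆ H.verts ∧ (A.card : ℝ) ≤ c * n ∧
            ∀ S : Finset V, S ⊆ H.verts \ A → (S.card : ℝ) ≤ c ^ 2 * n → 5 ∣ S.card →
              KGraph.HasPerfectTiling generalisedTriangle (H.induce (A ∪ S)) := by
  intro α₁ hα₁
  -- Lowering `α` only weakens the codegree condition.
  set α := min α₁ (1 / 3) with hαd
  have hα : 0 < α := lt_min hα₁ (by norm_num)
  have hα' : α ≤ 1 / 3 := min_le_right _ _
  obtain ⟨ε, hε⟩ : ∃ ε, ε = α ^ 2 / 12800000 := ⟨_, rfl⟩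
  have hε0 : 0 < ε := by rw [hε]; positivity
  have hε1 : ε ≤ 1 := by rw [hε]; nlinarith
  set θ : ℝ := (ε / 4 / 2) ^ 75 / 2 with hθ
  have hθ0 : 0 < θ := by positivity
  have hθ1 : θ ≤ 1 / 2 := by
    have : (ε / 4 / 2) ^ 75 ≤ 1 := pow_le_one₀ (by positivity) (by linarith)
    linarith
  -- The bound `ε / 16`, with `n ≥ 80 / ε`, leaves room for all `N` absorbers: `c n + 5 ≤ ε n / 8`.
  -- The bound `θ / 30` makes `|S| / 5` at most `θ c n / 150`, about half of `θ N`.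
  refine ⟨min (ε / 16) (θ / 30), by positivity, fun c hc hcc => ?_⟩
  have hc1 : c < ε / 16 := hcc.trans_le (min_le_left _ _)
  have hc2 : c < θ / 30 := hcc.trans_le (min_le_right _ _)
  have hev : ∀ᶠ n : ℕ in Filter.atTop, (n : ℝ) ^ 5 < Real.exp (θ * c / 150 * n - 1) ∧
      80 / ε ≤ n := (eventually_pow_lt_exp (by positivity)).and
    (tendsto_natCast_atTop_atTop.eventually_ge_atTop _)
  obtain ⟨n₀, hn₀⟩ := Filter.eventually_atTop.1 hev
  refine ⟨n₀, fun n hn V _ H hHn hcod => ?_⟩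
  obtain ⟨hexp, hnε⟩ := hn₀ n hn
  rw [div_le_iff₀ hε0] at hnε
  have hn0 : (0 : ℝ) ≤ n := Nat.cast_nonneg n
  have hn80 : (80 : ℝ) ≤ n := by nlinarith
  have h : H.CodegreeGE α := by
    refine KGraph.codegreeGE_of_minCodegree ?_
    rw [hHn]
    have : α * n ≤ α₁ * n := mul_le_mul_of_nonneg_right (min_le_left _ _) hn0
    linarith
  have hex : ∀ x ∈ H.verts, ∀ y ∈ H.verts, Many H.verts (ε / 4) 14 (H.Exchanges x y) :=
    fun x hx y hy => h.many_exchanges hα hα' hε (by rw [hHn]; linarith) hx hy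
  have habs : ∀ S ∈ H.verts.powersetCard 5, Many H.verts (ε / 4) 75 fun l => l.Nodup →
      (∀ v ∈ l, v ∉ S) → H.Tileable l.toFinset ∧ H.Tileable (l.toFinset ∪ S) := fun S hS =>
    h.many_absorbing hα (by linarith) (by rw [hHn]; linarith) hex hS
  set N := ⌊c * n / 75⌋₊ with hNd
  have hN : (75 : ℝ) * N ≤ c * n := by
    have := Nat.floor_le (show 0 ≤ c * n / 75 by positivity)
    linarith
  have hN' : c * n / 75 - 1 < N := by
    have := Nat.lt_floor_add_one (c * n / 75)
    linarith
  obtain ⟨F, hFN, hF, hsum⟩ := KGraph.exists_absorbingFamily (m := 75) (by norm_num)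
    (by positivity) (by linarith) (by rw [hHn]; exact_mod_cast (by linarith : (5 : ℝ) ≤ n)) habs N (by
      rw [hHn]; push_cast; nlinarith)
  rw [← hθ] at hsum
  refine ⟨F.biUnion id, biUnion_subset.2 hF.subset, ?_, fun S hS hSc h5 => ?_⟩
  · have : (F.biUnion id).card ≤ F.card * 75 :=
      card_biUnion_le_card_mul _ _ _ fun t ht => (hF.card t ht).le
    rw [hFN, mul_comm] at this
    have : ((F.biUnion id).card : ℝ) ≤ 75 * N := by exact_mod_cast this
    linarith
  obtain ⟨q, hq⟩ := h5
  refine (KGraph.tileable_of_absorberCount q hF (hS.trans sdiff_subset) hq ?_ ?_).hasPerfectTiling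
  · intro t ht
    exact disjoint_left.2 fun v hvt hvS =>
      (mem_sdiff.1 (hS hvS)).2 (mem_biUnion.2 ⟨t, ht, hvt⟩)
  intro R hR
  by_contra! hlt
  -- A 5-set `R` with fewer than `q` absorbers alone has weight at least `2 ^ (-q)`, whereas the
  -- total weight is at most `(1 - θ) ^ N n⁵`. With `q ≤ θ c n / 150` and `θ ≤ 1/2` the exponents
  -- are incompatible.
  have h1 : (1 / 2 : ℝ) ^ q ≤ (1 - θ) ^ N * (n : ℝ) ^ 5 := by
    calc (1 / 2 : ℝ) ^ q ≤ (1 / 2 : ℝ) ^ H.absorberCount F R :=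
          pow_le_pow_of_le_one (by norm_num) (by norm_num) hlt.le
      _ ≤ ∑ S ∈ H.verts.powersetCard 5, (1 / 2 : ℝ) ^ H.absorberCount F S :=
          single_le_sum (f := fun S => (1 / 2 : ℝ) ^ H.absorberCount F S)
            (fun S _ => by positivity) hR
      _ ≤ _ := hsum
      _ ≤ _ := by
          refine mul_le_mul_of_nonneg_left ?_ (pow_nonneg (by linarith) _)
          rw [card_powersetCard, hHn]
          exact_mod_cast Nat.choose_le_pow n 5
  have h2 : Real.exp (-q) ≤ (1 / 2 : ℝ) ^ q := by
    have : Real.exp (-1) ≤ 1 / 2 := by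
      rw [Real.exp_neg, inv_le_comm₀ (Real.exp_pos _) (by norm_num)]
      have := Real.add_one_le_exp (1 : ℝ)
      linarith
    calc Real.exp (-q) = Real.exp (-1) ^ q := by rw [← Real.exp_nat_mul]; ring_nf
      _ ≤ _ := pow_le_pow_left₀ (Real.exp_pos _).le this q
  have h3 : (1 - θ) ^ N ≤ Real.exp (-(θ * N)) := by
    calc (1 - θ) ^ N ≤ Real.exp (-θ) ^ N :=
          pow_le_pow_left₀ (by linarith) (Real.one_sub_le_exp_neg θ) N
      _ = _ := by rw [← Real.exp_nat_mul]; ring_nf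
  have h4 : Real.exp (-q) < Real.exp (-(θ * N)) * Real.exp (θ * c / 150 * n - 1) :=
    calc Real.exp (-q) ≤ Real.exp (-(θ * N)) * (n : ℝ) ^ 5 :=
          h2.trans (h1.trans (mul_le_mul_of_nonneg_right h3 (by positivity)))
      _ < _ := mul_lt_mul_of_pos_left hexp (Real.exp_pos _)
  rw [← Real.exp_add, Real.exp_lt_exp] at h4
  have h5 : (5 : ℝ) * q ≤ c ^ 2 * n := by rw [hq] at hSc; exact_mod_cast hSc
  have h6 : c ^ 2 * n ≤ c * (θ / 30) * n := by
    refine mul_le_mul_of_nonneg_right ?_ hn0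
    rw [sq]
    exact mul_le_mul_of_nonneg_left hc2.le hc.le
  have h7 : θ * (c * n / 75 - 1) ≤ θ * N := mul_le_mul_of_nonneg_left hN'.le hθ0.le
  linarith
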